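/- Let $B^4\subset\mathbb R^4$ be the open unit ball, $\iota:\partial B^4\to\overline{B}{}^4$ the inclusion, and identify $\mathfrak{so}(3)\cong\mathfrak{su}(2)\cong\operatorname{Im}\mathbb H$, so that an $\mathfrak{so}(3)$-valued form is written $A=A_1i+A_2j+A_3k$ with real-valued forms $A_l$. For a $2$-form $\omega$ let $\omega^-=\frac12(\omega-\ast\omega)$ be its anti-self-dual part. For an $\mathfrak{so}(3)$-valued $1$-form $a$ on $\partial B^4$, a solution of the linear Dirichlet problem with boundary value $a$ is an $\mathfrak{so}(3)$-valued $1$-form $A$, smooth up to the boundary, with $d^\ast dA=0$ in $B^4$ and $\iota^\ast A=a+d\xi$ for some smooth $\xi:\partial B^4\to\mathfrak{so}(3)$. For $p\in B^4$ let $h_p=h_{p,1}i+h_{p,2}j+h_{p,3}k$ be the $\operatorname{Im}\mathbb H$-valued $1$-form with harmonic coefficients in $B^4$, continuous on $\overline{B}{}^4$, with $$h_p(x)=\operatorname{Im}\frac{(\bar x-\bar p)\,dx}{|x-p|^4}\quad\text{for } x\in\partial B^4$$ (all components prescribed), where $x=x^1+x^2i+x^3j+x^4k$. Whenever the linear Dirichlet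 problem with boundary value $a$ is solvable, let $M(a,p)$ be the real $3\times3$ matrix with entries $$m_{ij}(a,p)=\int_{B^4}\bigl((dA_j)^-,(dh_{p,i})^-\bigr)\,dx ,$$ where $A$ is any solution with boundary value $a$; the integrals converge and do not depend on the choice of $A$. Let $\beta_1^-=x^1dx^2-x^3dx^4$, $\beta_2^-=x^1dx^3+x^2dx^4$, $\beta_3^-=x^1dx^4-x^2dx^3$. Let $A_0$ be an $\mathfrak{so}(3)$-valued $1$-form on $\partial B^4$ and let $\underline A_0$ be any solution of the linear Dirichlet problem with boundary value $A_0$. For a real $3\times3$ matrix $\mathsf A=(a_{ij})$ put $$\underline B_{0,l}(\mathsf A)=\underline A_{0,l}+a_{1l}\beta_1^-+a_{2l}\beta_2^-+a_{3l}\beta_3^-\quad(1\le l\le3),\qquad B_0(\mathsf A)=\iota^\ast\underline B_0(\mathsf A).$$ **Proposition.** Let $p_0\in B^4$. For every real $3\times3$ matrix $M$ there is a real $3\times3$ matrix $\mathsf A$ such that $M(B_0(\mathsf A),p_0)$ is well defined and $M(B_0(\mathsf A),p_0)=M$. Consequently, each of the following conditions on $N=M(B_0(\mathsf A),p_0)$,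 where $\mu_1\ge\mu_2\ge\mu_3$ denote the eigenvalues of $N^tN$, holds for a suitable choice of $\mathsf A$: 1. $\det N>0$, $\mu_1>\mu_2>\mu_3$ and $\sqrt{\mu_1}>\sqrt{\mu_2}+\sqrt{\mu_3}$; 2. $\det N<0$ and $\mu_1>\mu_2>\mu_3$; 3. $\det N<0$, $\mu_1>\mu_2>\mu_3$ and $\sqrt{\mu_1}<\sqrt{\mu_2}+\sqrt{\mu_3}$; 4. $\det N=0$ and $\mu_1>\mu_2>0$. -/

import Mathlib

open Metric MeasureTheory InnerProductSpace
open scoped Manifold ContDiff Matrix Quaternion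

noncomputable section

/-- Euclidean `ℝ⁴`; the standard coordinates `x¹, …, x⁴` are `x 0, …, x 3`. -/
abbrev E4 : Type := EuclideanSpace ℝ (Fin 4)

/-- The open unit ball `B⁴`. -/
abbrev B4 : Set E4 := ball 0 1

/-- The unit sphere `S³ = ∂B⁴` as a manifold. -/
abbrev S3 : Type := sphere (0 : E4) 1

instance factFinrankE4 : Fact (Module.finrank ℝ E4 = 3 + 1) := ⟨by simp⟩

/-- The constant vector field `∂/∂xⁱ`. -/
def stdVec (i : Fin 4) : E4 := EuclideanSpace.single i 1

/-- A real-valued differential `1`-form on (a subset of) `ℝ⁴`. -/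
abbrev OneForm : Type := E4 → E4 [⋀^Fin 1]→L[ℝ] ℝ

/-- An `𝔰𝔬(3)`-valued `1`-form, with `𝔰𝔬(3) ≅ 𝔰𝔲(2) ≅ Im ℍ`: the form
`A₀ i + A₁ j + A₂ k` is recorded by its three real components. -/
abbrev LieOneForm : Type := Fin 3 → OneForm

/-- A real-valued `1`-form on `S³`: a covector on each tangent space of the sphere. -/
abbrev SphereOneForm : Type := ∀ y : S3, TangentSpace (𝓡 3) y →L[ℝ] ℝ

/-- An `𝔰𝔬(3)`-valued `1`-form on `S³`, by components as above. -/
abbrev SphereLieOneForm : Type := Fin 3 → SphereOneForm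

/-- The inclusion `ι : S³ → ℝ⁴`. -/
def sphereIncl (y : S3) : E4 := y

/-- The pull-back `ι^* A` of a `1`-form to the sphere:
`(ι^* A)_y (v) = A_y (dι_y v)`. -/
def spherePullback (A : OneForm) : SphereOneForm := fun y =>
  ((ContinuousAlternatingMap.ofSubsingleton ℝ E4 ℝ (0 : Fin 1)).symm (A y)).comp
    (mvfderiv (𝓡 3) sphereIncl y)

/-- The components `F_{ij} = F(∂_i, ∂_j)` of `F = ∑_{i<j} F_{ij} dxⁱ ∧ dxʲ`. -/
def twoFormCoeff (F : E4 [⋀^Fin 2]→L[ℝ] ℝ) : Matrix (Fin 4) (Fin 4) ℝ :=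
  Matrix.of fun i j => F ![stdVec i, stdVec j]

/-- The components of the exterior derivative `dA` of a `1`-form at `x`. -/
def curv (A : OneForm) (x : E4) : Matrix (Fin 4) (Fin 4) ℝ :=
  twoFormCoeff (extDeriv A x)

/-- Hodge star on `2`-forms of oriented Euclidean `ℝ⁴`, on the (skew) matrix of components:
`dx¹∧dx² ↔ dx³∧dx⁴`, `dx¹∧dx³ ↔ -dx²∧dx⁴`, `dx¹∧dx⁴ ↔ dx²∧dx³`. -/
def hodgeStar (F : Matrix (Fin 4) (Fin 4) ℝ) : Matrix (Fin 4) (Fin 4) ℝ :=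
  !![0, F 2 3, -F 1 3, F 1 2;
     -F 2 3, 0, F 0 3, -F 0 2;
     F 1 3, -F 0 3, 0, F 0 1;
     -F 1 2, F 0 2, -F 0 1, 0]

/-- The anti-self-dual part `F⁻ = (F - ⋆F) / 2`. -/
def asdPart (F : Matrix (Fin 4) (Fin 4) ℝ) : Matrix (Fin 4) (Fin 4) ℝ :=
  (1 / 2 : ℝ) • (F - hodgeStar F)

/-- The inner product of `2`-forms for which the `dxⁱ ∧ dxʲ` (`i < j`) are orthonormal. -/
def twoFormInner (F G : Matrix (Fin 4) (Fin 4) ℝ) : ℝ :=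
  ∑ i, ∑ j, if i < j then F i j * G i j else 0

/-- The codifferential of a `2`-form on Euclidean `ℝ⁴`: `(d^*F)_j = -∑_i ∂_i F_{ij}`. -/
def codiff (F : E4 → Matrix (Fin 4) (Fin 4) ℝ) (x : E4) (j : Fin 4) : ℝ :=
  -∑ i, fderiv ℝ (fun y => F y i j) x (stdVec i)

/-- `A` is a solution, smooth up to the boundary, of the linear Dirichlet problem
`d^* d A = 0` in `B⁴`, `ι^* A ∼ a` on `∂B⁴`. The gauge equivalence of this linear
(zero coupling) problem is `b ∼ a ↔ b = a + dξ` with `ξ : S³ → 𝔰𝔬(3)` smooth. -/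
structure SolvesLinearDirichlet (a : SphereLieOneForm) (A : LieOneForm) : Prop where
  smooth : ∀ l, ContDiffOn ℝ ∞ (A l) (closedBall 0 1)
  eqn : ∀ l, ∀ x ∈ B4, ∀ j, codiff (curv (A l)) x j = 0
  boundary : ∃ ξ : Fin 3 → S3 → ℝ, (∀ l, ContMDiff (𝓡 3) 𝓘(ℝ, ℝ) ∞ (ξ l)) ∧
    ∀ (l : Fin 3) (y : S3) (v : TangentSpace (𝓡 3) y),
      spherePullback (A l) y v = a l y v + mvfderiv (𝓡 3) (ξ l) y v

/-- The identification `x ↦ x¹ + x² i + x³ j + x⁴ k` of `ℝ⁴` with the quaternions. -/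
def toQuat (x : E4) : ℍ[ℝ] := ⟨x 0, x 1, x 2, x 3⟩

/-- The coefficients of `i, j, k`. -/
def imCoord (q : ℍ[ℝ]) : Fin 3 → ℝ := ![q.imI, q.imJ, q.imK]

/-- `h` is the harmonic `Im ℍ`-valued `1`-form `h_p` on `B⁴`, continuous up to the boundary,
with boundary values `h_p(x) = Im ((x̄ - p̄) dx) / |x - p|⁴` at `∂B⁴`
(all components, not only the tangential ones, are prescribed). -/
structure IsHarmonicPotential (p : E4) (h : LieOneForm) : Prop where
  harmonic : ∀ l, HarmonicContOnCl (h l) B4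
  boundary : ∀ l, ∀ x ∈ sphere (0 : E4) 1, ∀ v : E4,
    h l x ![v] = imCoord (star (toQuat (x - p)) * toQuat v) l / ‖x - p‖ ^ 4

/-- `M(a, p) = M`, where `M(a, p)_{ij} = ∫_{B⁴} ((dA_j)⁻, (dh_{p,i})⁻) dx` for a solution `A` of
the linear Dirichlet problem with boundary value `a`. The matrix is required to be well defined:
both Dirichlet problems are solvable, and all their solutions give convergent integrals with
the value `M`. -/
def IsBoundaryMatrix (a : SphereLieOneForm) (p : E4) (M : Matrix (Fin 3) (Fin 3) ℝ) : Prop :=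
  (∃ A, SolvesLinearDirichlet a A) ∧ (∃ h, IsHarmonicPotential p h) ∧
    ∀ A h, SolvesLinearDirichlet a A → IsHarmonicPotential p h → ∀ i j : Fin 3,
      IntegrableOn (fun x => twoFormInner (asdPart (curv (A j) x)) (asdPart (curv (h i) x))) B4 ∧
      M i j = ∫ x in B4, twoFormInner (asdPart (curv (A j) x)) (asdPart (curv (h i) x))

/-- The coordinate `1`-form `dxⁱ`. -/
def dx (i : Fin 4) : E4 [⋀^Fin 1]→L[ℝ] ℝ :=
  ContinuousAlternatingMap.ofSubsingleton ℝ E4 ℝ (0 : Fin 1) (EuclideanSpace.proj i)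

/-- The linear potentials `β₁⁻ = x¹dx² - x³dx⁴`, `β₂⁻ = x¹dx³ + x²dx⁴`, `β₃⁻ = x¹dx⁴ - x²dx³`. -/
def asdPotential : Fin 3 → OneForm :=
  ![fun x => x 0 • dx 1 - x 2 • dx 3,
    fun x => x 0 • dx 2 + x 1 • dx 3,
    fun x => x 0 • dx 3 - x 1 • dx 2]

/-- The extended connection with components `A_l + a_{1l} β₁⁻ + a_{2l} β₂⁻ + a_{3l} β₃⁻`. -/
def shiftedConnection (A : LieOneForm) (a : Matrix (Fin 3) (Fin 3) ℝ) : LieOneForm :=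
  fun l x => A l x + ∑ k, a k l • asdPotential k x

/-- The boundary connection `B₀(a)`: the pull-back of the extended connection to `S³`. -/
def shiftedBoundary (A : LieOneForm) (a : Matrix (Fin 3) (Fin 3) ℝ) : SphereLieOneForm :=
  fun l => spherePullback (shiftedConnection A a l)

/-- `μ₁ ≥ μ₂ ≥ μ₃` are the eigenvalues, with multiplicity, of `Mᵗ M`. -/
def AreGramEigenvalues (M : Matrix (Fin 3) (Fin 3) ℝ) (μ₁ μ₂ μ₃ : ℝ) : Prop :=
  μ₂ ≤ μ₁ ∧ μ₃ ≤ μ₂ ∧ (Mᵀ * M).charpoly.roots = {μ₁, μ₂, μ₃}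

/-- `det M > 0`, `μ₁ > μ₂ > μ₃` and `√μ₁ > √μ₂ + √μ₃`. -/
def PositiveCase (M : Matrix (Fin 3) (Fin 3) ℝ) : Prop :=
  0 < M.det ∧ ∃ μ₁ μ₂ μ₃, AreGramEigenvalues M μ₁ μ₂ μ₃ ∧ μ₂ < μ₁ ∧ μ₃ < μ₂ ∧
    √μ₂ + √μ₃ < √μ₁

/-- `det M < 0` and `μ₁ > μ₂ > μ₃`. -/
def NegativeCase (M : Matrix (Fin 3) (Fin 3) ℝ) : Prop :=
  M.det < 0 ∧ ∃ μ₁ μ₂ μ₃, AreGramEigenvalues M μ₁ μ₂ μ₃ ∧ μ₂ < μ₁ ∧ μ₃ < μ₂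

/-- The negative case with the additional condition `√μ₁ < √μ₂ + √μ₃`. -/
def NegativeTriangleCase (M : Matrix (Fin 3) (Fin 3) ℝ) : Prop :=
  M.det < 0 ∧ ∃ μ₁ μ₂ μ₃, AreGramEigenvalues M μ₁ μ₂ μ₃ ∧ μ₂ < μ₁ ∧ μ₃ < μ₂ ∧
    √μ₁ < √μ₂ + √μ₃

/-- `det M = 0` and `μ₁ > μ₂ > 0`. -/
def DegenerateCase (M : Matrix (Fin 3) (Fin 3) ℝ) : Prop :=
  M.det = 0 ∧ ∃ μ₁ μ₂ μ₃, AreGramEigenvalues M μ₁ μ₂ μ₃ ∧ μ₂ < μ₁ ∧ 0 < μ₂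

end

noncomputable section

/-! The matrix depends affinely on the shift, with an invertible linear part: M(B₀(a), p) = M(A₀, p)
+ 4 vol(B⁴) a. Every M is therefore attained, and diagonal matrices realise the four cases.

Linear part. Each β_k⁻ is linear with constant anti-self-dual curvature, so adding it preserves d*dA
= 0 and contributes ∫ (dβ_k⁻, (dh_p)⁻). The potential is explicit: h_p = Im(K̄ dx), where K is the
Kelvin transform of (x - p)/|x - p|⁴. It is regular on the closed ball, harmonic, and equal to the
original field on the sphere. The integrand is a linear functional of DK, hence harmonic, and the
mean value property evaluates the integral at 0, where DK = id for every p. There d Im(x̄ dx) has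
components 2 dβ_l⁻, and the pairing is 4 if k = l and 0 otherwise (`integral_asdPairing`,
`asdPairing_asdBasis_id`).

Well-definedness. The maximum principle makes h_p unique. Two solutions A, A' differ on the boundary
by a gauge term; after subtracting an exact form dY, the difference C has no tangential part on the
sphere and coclosed curvature F, and integrating div(∑ F_ij C_j) = ½ ∑ F_ij² gives F = 0 almost
everywhere (`ae_curl_eq_zero`).

The energy identity and the mean value property both rest on one divergence theorem
(`integral_divergence_ball_eq_zero`), in which the boundary flux is replaced by the bound |V·x| ≤
K(1 - |x|). -/

/-! ### Coordinates and the Laplacian on ℝ⁴ -/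

theorem stdVec_apply (i k : Fin 4) : stdVec i k = if k = i then 1 else 0 := by
  simp [stdVec]

theorem sum_smul_stdVec (x : E4) : ∑ i, x i • stdVec i = x := by
  ext k
  simp [stdVec_apply]

theorem fderiv_eq_sum_stdVec {f : E4 → ℝ} (x v : E4) :
    fderiv ℝ f x v = ∑ i, v i * fderiv ℝ f x (stdVec i) := by
  conv_lhs => rw [← sum_smul_stdVec v]
  simp [map_sum]

theorem laplacian_eq_sum_stdVec {F : Type*} [NormedAddCommGroup F] [NormedSpace ℝ F]
    {f : E4 → F} {x : E4} (hf : ContDiffAt ℝ 2 f x) :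
    Laplacian.laplacian f x = ∑ i, fderiv ℝ (fun y => fderiv ℝ f y (stdVec i)) x (stdVec i) := by
  have hd : DifferentiableAt ℝ (fderiv ℝ f) x :=
    (hf.fderiv_right (m := 1) (by norm_num)).differentiableAt (by simp)
  rw [laplacian_eq_iteratedFDeriv_orthonormalBasis f (EuclideanSpace.basisFun (Fin 4) ℝ)]
  refine Finset.sum_congr rfl fun i _ => ?_
  rw [iteratedFDeriv_two_apply, fderiv_clm_apply hd (by fun_prop)]
  simp [stdVec]

/-! ### The divergence theorem on the ball via cutoffs -/

/-- A radial cutoff supported in the ball of radius `√(1 - 1/(n+1))`. -/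
def ballCutoff (n : ℕ) (x : E4) : ℝ := Real.smoothTransition ((n + 1) * (1 - ‖x‖ ^ 2) - 1)

theorem contDiff_ballCutoff (n : ℕ) : ContDiff ℝ ∞ (ballCutoff n) := by
  unfold ballCutoff
  have := contDiff_norm_sq ℝ (E := E4) (n := ∞)
  exact Real.smoothTransition.contDiff.comp (by fun_prop)

theorem ballCutoff_eventually_eq_zero (n : ℕ) {x : E4} (hx : x ∉ B4) :
    ∀ᶠ y in nhds x, ballCutoff n y = 0 := by
  have hx : 1 ≤ ‖x‖ := by simpa using hx
  have hc : Continuous fun y : E4 => ((n : ℝ) + 1) * (1 - ‖y‖ ^ 2) - 1 := by fun_prop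
  -- The summand -1 keeps the argument strictly negative even on the unit sphere, so vanishing
  -- persists on a neighbourhood.
  have h1 : ((n : ℝ) + 1) * (1 - ‖x‖ ^ 2) - 1 < 0 := by
    have : 1 - ‖x‖ ^ 2 ≤ 0 := by nlinarith
    nlinarith [(Nat.cast_nonneg n : (0 : ℝ) ≤ n)]
  filter_upwards [hc.continuousAt.eventually_lt_const h1] with y hy
  exact Real.smoothTransition.zero_of_nonpos hy.le

theorem fderiv_ballCutoff (n : ℕ) (x : E4) (i : Fin 4) :
    fderiv ℝ (ballCutoff n) x (stdVec i) =
      deriv Real.smoothTransition ((n + 1) * (1 - ‖x‖ ^ 2) - 1) * ((n + 1) * (-2 * x i)) := by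
  have h1 : HasFDerivAt (fun y : E4 => ‖y‖ ^ 2) (2 • innerSL ℝ x) x :=
    (hasStrictFDerivAt_norm_sq x).hasFDerivAt
  have h2 := ((h1.const_sub 1).const_mul ((n : ℝ) + 1)).sub_const 1
  have h3 := ((Real.smoothTransition.contDiff (n := 1)).differentiable (by simp)
    ((n + 1) * (1 - ‖x‖ ^ 2) - 1)).hasDerivAt.comp_hasFDerivAt x h2
  have h4 : HasFDerivAt (ballCutoff n) _ x := h3
  rw [h4.fderiv]
  simp [stdVec, EuclideanSpace.inner_single_right]

/-- Confines the gradient of the cutoff to the shell 1 ≤ (n+1)(1 - |x|²) ≤ 2, whose width is O(1/n).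
-/
theorem deriv_smoothTransition_eq_zero {t : ℝ} (ht : t < 0 ∨ 1 < t) :
    deriv Real.smoothTransition t = 0 := by
  rcases ht with ht | ht
  · have : Real.smoothTransition =ᶠ[nhds t] fun _ => 0 := by
      filter_upwards [eventually_lt_nhds ht] with s hs
      exact Real.smoothTransition.zero_of_nonpos hs.le
    rw [this.deriv_eq]; simp
  · have : Real.smoothTransition =ᶠ[nhds t] fun _ => 1 := by
      filter_upwards [eventually_gt_nhds ht] with s hs
      exact Real.smoothTransition.one_of_one_le hs.le
    rw [this.deriv_eq]; simp

theorem exists_bound_deriv_smoothTransition :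
    ∃ C, 0 ≤ C ∧ ∀ t, |deriv Real.smoothTransition t| ≤ C := by
  have hc : Continuous (deriv Real.smoothTransition) :=
    (Real.smoothTransition.contDiff (n := 1)).continuous_deriv (by simp)
  obtain ⟨C, hC⟩ := (isCompact_Icc (a := (0 : ℝ)) (b := 1)).exists_bound_of_continuousOn
    hc.continuousOn
  refine ⟨max C 0, le_max_right _ _, fun t => ?_⟩
  by_cases ht : t ∈ Set.Icc (0 : ℝ) 1
  · exact (hC t ht).trans (le_max_left _ _)
  · rw [Set.mem_Icc, not_and_or, not_le, not_le] at ht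
    simp [deriv_smoothTransition_eq_zero ht]

theorem integral_fderiv_eq_zero_of_hasCompactSupport {f : E4 → ℝ} (hf : ContDiff ℝ 1 f)
    (hs : HasCompactSupport f) (v : E4) : ∫ x, fderiv ℝ f x v = 0 := by
  have hc : Continuous fun x => fderiv ℝ f x v :=
    (hf.continuous_fderiv (by simp)).clm_apply continuous_const
  have hi : Integrable fun x => fderiv ℝ f x v :=
    hc.integrable_of_hasCompactSupport (hs.fderiv_apply ℝ v)
  have h := integral_mul_fderiv_eq_neg_fderiv_mul_of_integrable (μ := volume)
    (f := fun _ : E4 => (1 : ℝ)) (g := f) (v := v) (by simp) (by simpa using hi)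
    (by simpa using hf.continuous.integrable_of_hasCompactSupport hs)
    (fun x _ => by fun_prop) (fun x _ => hf.differentiable (by simp) x)
  simpa using h

/-- The divergence theorem on the unit ball, for vector fields tangent to the sphere. -/
theorem integral_divergence_ball_eq_zero {V : Fin 4 → E4 → ℝ}
    (hV : ∀ i, ContDiffOn ℝ 1 (V i) B4) {K : ℝ}
    (hK : ∀ x ∈ B4, |∑ i, V i x * x i| ≤ K * (1 - ‖x‖))
    (hint : IntegrableOn (fun x => ∑ i, fderiv ℝ (V i) x (stdVec i)) B4) :
    ∫ x in B4, ∑ i, fderiv ℝ (V i) x (stdVec i) = 0 := by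
  obtain ⟨C, hC0, hC⟩ := exists_bound_deriv_smoothTransition
  have hK0 : 0 ≤ K := by
    have := hK 0 (by simp)
    simpa using (abs_nonneg _).trans this
  have hVd : ∀ i, ∀ x ∈ B4, DifferentiableAt ℝ (V i) x := fun i x hx =>
    ((hV i).contDiffAt (isOpen_ball.mem_nhds hx)).differentiableAt (by simp)
  have hφd : ∀ n x, DifferentiableAt ℝ (ballCutoff n) x := fun n x =>
    (contDiff_ballCutoff n).differentiable (by simp) x
  let W : ℕ → Fin 4 → E4 → ℝ := fun n i x => ballCutoff n x * V i x
  have hW0 : ∀ n i x, x ∉ B4 → W n i =ᶠ[nhds x] fun _ => 0 := fun n i x hx => by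
    filter_upwards [ballCutoff_eventually_eq_zero n hx] with y hy
    simp [W, hy]
  have hWc : ∀ n i, ContDiff ℝ 1 (W n i) := fun n i => by
    rw [contDiff_iff_contDiffAt]
    intro x
    by_cases hx : x ∈ B4
    · exact ((contDiff_ballCutoff n).contDiffAt.of_le (by simp)).mul
        ((hV i).contDiffAt (isOpen_ball.mem_nhds hx))
    · exact contDiffAt_const.congr_of_eventuallyEq (hW0 n i x hx)
  have hWs : ∀ n i, HasCompactSupport (W n i) := fun n i =>
    HasCompactSupport.intro (isCompact_closedBall (0 : E4) 1) fun x hx =>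
      (hW0 n i x fun h => hx (ball_subset_closedBall h)).self_of_nhds
  -- The cutoff is radial, so its gradient sees V only through V·x.
  have hform : ∀ n, ∀ x ∈ B4, ∑ i, fderiv ℝ (W n i) x (stdVec i) =
      ballCutoff n x * ∑ i, fderiv ℝ (V i) x (stdVec i) +
        deriv Real.smoothTransition ((n + 1) * (1 - ‖x‖ ^ 2) - 1) * ((n + 1) * (-2)) *
          ∑ i, V i x * x i := fun n x hx => by
    rw [Finset.mul_sum, Finset.mul_sum, ← Finset.sum_add_distrib]
    refine Finset.sum_congr rfl fun i _ => ?_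
    have : fderiv ℝ (W n i) x = _ := fderiv_mul (hφd n x) (hVd i x hx)
    rw [this]
    simp only [add_apply, smul_apply, smul_eq_mul,
      fderiv_ballCutoff]
    ring
  have hzero : ∀ n, ∫ x in B4, ∑ i, fderiv ℝ (W n i) x (stdVec i) = 0 := fun n => by
    rw [setIntegral_eq_integral_of_forall_compl_eq_zero, integral_finsetSum]
    · exact Finset.sum_eq_zero fun i _ =>
        integral_fderiv_eq_zero_of_hasCompactSupport (hWc n i) (hWs n i) _
    · intro i _
      exact (((hWc n i).continuous_fderiv (by simp)).clm_apply
        continuous_const).integrable_of_hasCompactSupport ((hWs n i).fderiv_apply ℝ _)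
    · intro x hx
      refine Finset.sum_eq_zero fun i _ => ?_
      rw [(hW0 n i x hx).fderiv_eq]; simp
  have hlim : Filter.Tendsto (fun n => ∫ x in B4, ∑ i, fderiv ℝ (W n i) x (stdVec i))
      Filter.atTop (nhds (∫ x in B4, ∑ i, fderiv ℝ (V i) x (stdVec i))) := by
    refine tendsto_integral_of_dominated_convergence
      (fun x => ‖∑ i, fderiv ℝ (V i) x (stdVec i)‖ + 4 * C * K) ?_ ?_ ?_ ?_
    · intro n
      refine Continuous.aestronglyMeasurable ?_
      exact continuous_finsetSum _ fun i _ => ((hWc n i).continuous_fderiv (by simp)).clm_apply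
        continuous_const
    · exact hint.norm.add (integrableOn_const (by simp [measure_ball_lt_top.ne]))
    · intro n
      refine (ae_restrict_iff' measurableSet_ball).2 (Filter.Eventually.of_forall fun x hx => ?_)
      have hx1 : ‖x‖ < 1 := by simpa using hx
      rw [hform n x hx]
      refine (norm_add_le _ _).trans (add_le_add ?_ ?_)
      · rw [norm_mul]
        refine mul_le_of_le_one_left (norm_nonneg _) ?_
        rw [ballCutoff, Real.norm_of_nonneg (Real.smoothTransition.nonneg _)]
        exact Real.smoothTransition.le_one _
      · by_cases ht : 1 < ((n : ℝ) + 1) * (1 - ‖x‖ ^ 2) - 1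
        · rw [deriv_smoothTransition_eq_zero (Or.inr ht)]
          simp; positivity
        · push Not at ht
          have h1 := hC ((n + 1) * (1 - ‖x‖ ^ 2) - 1)
          have h2 := hK x hx
          have hn : (0 : ℝ) < n + 1 := by positivity
          -- In the shell the factor n+1 from the cutoff is absorbed by the flux bound K(1 - |x|),
          -- which gives the dominating constant 4CK uniformly in n.
          have h3 : ((n : ℝ) + 1) * (1 - ‖x‖) ≤ 2 := by
            have : 1 - ‖x‖ ≤ 1 - ‖x‖ ^ 2 := by nlinarith [norm_nonneg x]
            nlinarith
          rw [norm_mul, norm_mul, Real.norm_eq_abs, Real.norm_eq_abs, Real.norm_eq_abs]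
          have h4 : |((n : ℝ) + 1) * (-2)| = (n + 1) * 2 := by
            rw [abs_mul, abs_of_pos hn]; norm_num
          rw [h4]
          calc _ ≤ C * ((n + 1) * 2) * (K * (1 - ‖x‖)) := by gcongr
            _ = 2 * C * K * ((n + 1) * (1 - ‖x‖)) := by ring
            _ ≤ 2 * C * K * 2 := by gcongr
            _ = _ := by ring
    · refine (ae_restrict_iff' measurableSet_ball).2 (Filter.Eventually.of_forall fun x hx => ?_)
      have hx1 : ‖x‖ < 1 := by simpa using hx
      have hp : 0 < 1 - ‖x‖ ^ 2 := by nlinarith [norm_nonneg x]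
      obtain ⟨N, hN⟩ := exists_nat_gt (2 / (1 - ‖x‖ ^ 2))
      refine tendsto_const_nhds.congr' ?_
      filter_upwards [Filter.eventually_ge_atTop N] with n hn
      have hn' : (N : ℝ) ≤ n := by exact_mod_cast hn
      -- For n large the fixed point x lies where the cutoff is constantly 1, so the product has the
      -- divergence of V there.
      have ht : 1 < ((n : ℝ) + 1) * (1 - ‖x‖ ^ 2) - 1 := by
        rw [div_lt_iff₀ hp] at hN
        nlinarith
      rw [hform n x hx, deriv_smoothTransition_eq_zero (Or.inr ht), ballCutoff,
        Real.smoothTransition.one_of_one_le ht.le]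
      simp
  simp only [hzero] at hlim
  exact (tendsto_nhds_unique hlim tendsto_const_nhds)

/-! ### The mean value property -/

theorem fderiv_norm_sq_stdVec (x : E4) (i : Fin 4) :
    fderiv ℝ (fun y : E4 => ‖y‖ ^ 2) x (stdVec i) = 2 * x i := by
  have h1 : HasFDerivAt (fun y : E4 => ‖y‖ ^ 2) (2 • innerSL ℝ x) x :=
    (hasStrictFDerivAt_norm_sq x).hasFDerivAt
  rw [h1.fderiv]
  simp [stdVec, EuclideanSpace.inner_single_right]

/-- The gradient of a harmonic function is orthogonal to the Euler field on concentric balls. -/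
theorem integral_fderiv_smul_self_eq_zero {f : E4 → ℝ}
    (hf : HarmonicOnNhd f (closedBall (0 : E4) 1)) {r : ℝ} (hr0 : 0 ≤ r) (hr1 : r ≤ 1) :
    ∫ x in B4, fderiv ℝ f (r • x) x = 0 := by
  have hmem : ∀ x ∈ closedBall (0 : E4) 1, r • x ∈ closedBall (0 : E4) 1 := fun x hx => by
    simp only [mem_closedBall, dist_zero_right] at hx ⊢
    rw [norm_smul, Real.norm_of_nonneg hr0]
    nlinarith [norm_nonneg x]
  have hcd : ∀ x ∈ closedBall (0 : E4) 1, ContDiffAt ℝ 1 (fderiv ℝ f) (r • x) := fun x hx =>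
    (hf _ (hmem x hx)).1.fderiv_right (m := 1) (by norm_num)
  have hcdi : ∀ i, ∀ x ∈ closedBall (0 : E4) 1,
      ContDiffAt ℝ 1 (fun y => fderiv ℝ f (r • y) (stdVec i)) x := fun i x hx =>
    ((hcd x hx).comp x (by fun_prop : ContDiffAt ℝ 1 (fun y : E4 => r • y) x)).clm_apply
      contDiffAt_const
  have hqd : ∀ x, ContDiffAt ℝ 1 (fun y : E4 => (‖y‖ ^ 2 - 1) / 2) x := fun x =>
    (((contDiff_norm_sq ℝ).contDiffAt).sub contDiffAt_const).div_const 2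
  -- The factor vanishes on the sphere and has gradient x. Hence div V = x·∇f(rx) + r (|x|² - 1)/2
  -- Δf(rx), whose last term is zero.
  let V : Fin 4 → E4 → ℝ := fun i x => (‖x‖ ^ 2 - 1) / 2 * fderiv ℝ f (r • x) (stdVec i)
  have hcont : ContinuousOn (fun x => fderiv ℝ f (r • x)) (closedBall (0 : E4) 1) := fun x hx =>
    ((hcd x hx).continuousAt.comp (f := fun y : E4 => r • y)
      (by fun_prop)).continuousWithinAt
  have hcont' : ContinuousOn (fun x => fderiv ℝ f (r • x) x) (closedBall (0 : E4) 1) :=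
    hcont.clm_apply continuousOn_id
  obtain ⟨C, hC⟩ := (isCompact_closedBall (0 : E4) 1).exists_bound_of_continuousOn hcont'
  have hV : ∀ i, ContDiffOn ℝ 1 (V i) B4 := fun i x hx =>
    ((hqd x).mul (hcdi i x (ball_subset_closedBall hx))).contDiffWithinAt
  have hVx : ∀ x, ∑ i, V i x * x i = (‖x‖ ^ 2 - 1) / 2 * fderiv ℝ f (r • x) x := fun x => by
    rw [fderiv_eq_sum_stdVec (r • x) x, Finset.mul_sum]
    exact Finset.sum_congr rfl fun i _ => by simp only [V]; ring
  have hdiv : ∀ x ∈ B4, ∑ i, fderiv ℝ (V i) x (stdVec i) = fderiv ℝ f (r • x) x := by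
    intro x hx
    have hx' := ball_subset_closedBall hx
    have hterm : ∀ i, fderiv ℝ (V i) x (stdVec i) =
        x i * fderiv ℝ f (r • x) (stdVec i) + (‖x‖ ^ 2 - 1) / 2 * r *
          fderiv ℝ (fun y => fderiv ℝ f y (stdVec i)) (r • x) (stdVec i) := fun i => by
      have h1 : fderiv ℝ (V i) x = _ := fderiv_mul ((hqd x).differentiableAt (by simp))
        ((hcdi i x hx').differentiableAt (by simp))
      have h2 : fderiv ℝ (fun y : E4 => (‖y‖ ^ 2 - 1) / 2) x (stdVec i) = x i := by
        have h := fderiv_norm_sq_stdVec x i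
        have hd : DifferentiableAt ℝ (fun y : E4 => ‖y‖ ^ 2) x :=
          (contDiff_norm_sq ℝ (n := 1)).differentiable (by simp) x
        simp only [div_eq_mul_inv]
        rw [fderiv_mul_const (hd.sub_const 1), fderiv_sub_const]
        simp only [smul_apply, smul_eq_mul, h]
        ring
      have h3 : fderiv ℝ (fun y => fderiv ℝ f (r • y) (stdVec i)) x (stdVec i) =
          r * fderiv ℝ (fun y => fderiv ℝ f y (stdVec i)) (r • x) (stdVec i) := by
        have hd : DifferentiableAt ℝ (fun y => fderiv ℝ f y (stdVec i)) (r • x) :=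
          ((hcd x hx').clm_apply contDiffAt_const).differentiableAt (by simp)
        have := (hd.hasFDerivAt.comp x ((hasFDerivAt_id x).const_smul r)).fderiv
        simp only [Function.comp_def] at this
        rw [this]
        simp
      rw [h1]
      simp only [add_apply, smul_apply, smul_eq_mul, h2, h3]
      ring
    rw [Finset.sum_congr rfl fun i _ => hterm i, Finset.sum_add_distrib, ← Finset.mul_sum,
      ← laplacian_eq_sum_stdVec (hf _ (hmem x hx')).1, (hf _ (hmem x hx')).2.self_of_nhds,
      ← fderiv_eq_sum_stdVec]
    simp
  rw [← setIntegral_congr_fun measurableSet_ball hdiv]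
  refine integral_divergence_ball_eq_zero hV (K := C) (fun x hx => ?_) ?_
  · have hx1 : ‖x‖ < 1 := by simpa using hx
    have hb := hC x (ball_subset_closedBall hx)
    rw [hVx, abs_mul, abs_div, abs_of_nonpos (by nlinarith [norm_nonneg x]),
      abs_of_pos (two_pos : (0 : ℝ) < 2)]
    rw [Real.norm_eq_abs] at hb
    have : -(‖x‖ ^ 2 - 1) / 2 ≤ 1 - ‖x‖ := by nlinarith [norm_nonneg x]
    calc _ ≤ (1 - ‖x‖) * C := mul_le_mul this hb (abs_nonneg _) (by linarith)
      _ = _ := mul_comm _ _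
  · refine IntegrableOn.congr_fun ?_ (fun x hx => (hdiv x hx).symm) measurableSet_ball
    exact (hcont'.integrableOn_compact (isCompact_closedBall _ _)).mono_set ball_subset_closedBall

/-- The mean value property on the unit ball. -/
theorem integral_ball_eq_of_harmonicOnNhd {f : E4 → ℝ}
    (hf : HarmonicOnNhd f (closedBall (0 : E4) 1)) :
    ∫ x in B4, f x = (volume B4).toReal * f 0 := by
  have hmem : ∀ x ∈ closedBall (0 : E4) 1, ∀ r ∈ Set.Icc (0 : ℝ) 1,
      r • x ∈ closedBall (0 : E4) 1 := fun x hx r hr => by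
    simp only [mem_closedBall, dist_zero_right] at hx ⊢
    rw [norm_smul, Real.norm_of_nonneg hr.1]
    nlinarith [norm_nonneg x, hr.1, hr.2]
  have hcont : ContinuousOn (fun q : E4 × ℝ => fderiv ℝ f (q.2 • q.1) q.1)
      (closedBall (0 : E4) 1 ×ˢ Set.Icc (0 : ℝ) 1) := fun q hq => by
    have h1 : ContinuousAt (fderiv ℝ f) (q.2 • q.1) :=
      ((hf _ (hmem q.1 hq.1 q.2 hq.2)).1.fderiv_right (m := 1) (by norm_num)).continuousAt
    have h2 : ContinuousAt (fun q : E4 × ℝ => fderiv ℝ f (q.2 • q.1)) q :=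
      h1.comp (f := fun q : E4 × ℝ => q.2 • q.1) (by fun_prop)
    exact (h2.clm_apply continuousAt_fst).continuousWithinAt
  have hint : Integrable (Function.uncurry fun (x : E4) (r : ℝ) => fderiv ℝ f (r • x) x)
      ((volume.restrict B4).prod (volume.restrict (Set.Ioc (0 : ℝ) 1))) := by
    rw [Measure.prod_restrict]
    exact (hcont.integrableOn_compact ((isCompact_closedBall _ _).prod isCompact_Icc)).mono_set
      (Set.prod_mono ball_subset_closedBall Set.Ioc_subset_Icc_self)
  -- Integrating this over the ball and exchanging the integrals leaves, for each r, an integral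
  -- already known to vanish.
  have hftc : ∀ x ∈ B4, ∫ r in Set.Ioc (0 : ℝ) 1, fderiv ℝ f (r • x) x = f x - f 0 := by
    intro x hx
    have hx' := ball_subset_closedBall hx
    rw [← intervalIntegral.integral_of_le zero_le_one]
    have := intervalIntegral.integral_eq_sub_of_hasDerivAt (a := 0) (b := 1)
      (f := fun r : ℝ => f (r • x)) (f' := fun r => fderiv ℝ f (r • x) x) (fun r hr => ?_) ?_
    · simpa using this
    · rw [Set.uIcc_of_le zero_le_one] at hr
      have hd : DifferentiableAt ℝ f (r • x) :=
        (hf _ (hmem x hx' r hr)).1.differentiableAt (by simp)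
      have h := hd.hasFDerivAt.comp_hasDerivAt r ((hasDerivAt_id r).smul_const x)
      simpa [Function.comp_def] using h
    · refine ContinuousOn.intervalIntegrable ?_
      rw [Set.uIcc_of_le zero_le_one]
      exact hcont.comp (f := fun r : ℝ => (x, r)) (by fun_prop) fun r hr => ⟨hx', hr⟩
  have hswap := integral_integral_swap hint
  rw [setIntegral_congr_fun measurableSet_ball hftc,
    setIntegral_congr_fun measurableSet_Ioc (g := fun _ => (0 : ℝ)) fun r hr =>
      integral_fderiv_smul_self_eq_zero hf hr.1.le hr.2] at hswap
  have hfi : IntegrableOn f B4 :=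
    (hf.continuousOn.integrableOn_compact (isCompact_closedBall _ _)).mono_set
      ball_subset_closedBall
  rw [integral_sub hfi (integrableOn_const (by simp [measure_ball_lt_top.ne]))] at hswap
  simp only [integral_zero, setIntegral_const, smul_eq_mul] at hswap
  exact sub_eq_zero.1 hswap

/-! ### Derivatives of harmonic functions -/

theorem fderiv_fderiv_apply_comm {F : Type*} [NormedAddCommGroup F] [NormedSpace ℝ F]
    {f : E4 → F} {x : E4} (hf : ContDiffAt ℝ 2 f x) (u v : E4) :
    fderiv ℝ (fun y => fderiv ℝ f y u) x v = fderiv ℝ (fun y => fderiv ℝ f y v) x u := by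
  have hd : DifferentiableAt ℝ (fderiv ℝ f) x :=
    (hf.fderiv_right (m := 1) (by norm_num)).differentiableAt (by simp)
  have hs : IsSymmSndFDerivAt ℝ f x := hf.isSymmSndFDerivAt (by simp)
  rw [fderiv_clm_apply hd (by fun_prop), fderiv_clm_apply hd (by fun_prop)]
  simpa using hs v u

/-- The Laplacian commutes with ∂_v. `HarmonicAt` carries only C² regularity, hence the separate C³
hypothesis. -/
theorem harmonicAt_fderiv_apply {F : Type*} [NormedAddCommGroup F] [NormedSpace ℝ F]
    {f : E4 → F} {x : E4} (hf : HarmonicAt f x) (hf3 : ContDiffAt ℝ 3 f x) (v : E4) :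
    HarmonicAt (fun y => fderiv ℝ f y v) x := by
  have hcd : ∀ {y}, ContDiffAt ℝ 3 f y → ∀ w, ContDiffAt ℝ 2 (fun y => fderiv ℝ f y w) y :=
    fun h w => (h.fderiv_right (m := 2) (by norm_num)).clm_apply contDiffAt_const
  refine ⟨hcd hf3 v, ?_⟩
  filter_upwards [hf3.eventually (by simp), hf.2.eventually_nhds] with y hy3 hy
  have hev := hy3.eventually (by simp)
  rw [laplacian_eq_sum_stdVec (hcd hy3 v)]
  -- Two exchanges of derivatives bring ∂_v outermost; the sum over i is then ∂_v of Δf, which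
  -- vanishes near y.
  have hterm : ∀ i, fderiv ℝ (fun z => fderiv ℝ (fun y => fderiv ℝ f y v) z (stdVec i)) y
      (stdVec i) = fderiv ℝ (fun z => fderiv ℝ (fun y => fderiv ℝ f y (stdVec i)) z (stdVec i))
        y v := fun i => by
    rw [← fderiv_fderiv_apply_comm (hcd hy3 (stdVec i))]
    congr 1
    refine Filter.EventuallyEq.fderiv_eq ?_
    filter_upwards [hev] with z hz
    exact fderiv_fderiv_apply_comm (hz.of_le (by norm_num)) _ _
  rw [Finset.sum_congr rfl fun i _ => hterm i]
  have hlap : Laplacian.laplacian f =ᶠ[nhds y]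
      fun z => ∑ i, fderiv ℝ (fun y => fderiv ℝ f y (stdVec i)) z (stdVec i) := by
    filter_upwards [hev] with z hz
    exact laplacian_eq_sum_stdVec (hz.of_le (by norm_num))
  have h0 : (fun z => ∑ i, fderiv ℝ (fun y => fderiv ℝ f y (stdVec i)) z (stdVec i))
      =ᶠ[nhds y] fun _ => (0 : F) := hlap.symm.trans hy
  have h1 := h0.fderiv_eq (𝕜 := ℝ)
  have hdiff : ∀ i ∈ Finset.univ, DifferentiableAt ℝ
      (fun z => fderiv ℝ (fun y => fderiv ℝ f y (stdVec i)) z (stdVec i)) y := fun i _ =>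
    (((hcd hy3 (stdVec i)).fderiv_right (m := 1) (by norm_num)).clm_apply
      contDiffAt_const).differentiableAt (by simp)
  rw [fderiv_fun_sum hdiff] at h1
  have h2 := congrArg (fun T : E4 →L[ℝ] F => T v) h1
  simpa using h2

theorem harmonicAt_fderiv {F : Type*} [NormedAddCommGroup F] [NormedSpace ℝ F]
    {f : E4 → F} {x : E4} (hf : HarmonicAt f x) (hf3 : ContDiffAt ℝ 3 f x) :
    HarmonicAt (fderiv ℝ f) x := by
  refine ⟨hf3.fderiv_right (m := 2) (by norm_num), ?_⟩
  filter_upwards [hf3.eventually (by simp), hf.eventually] with y hy3 hy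
  ext v
  have h1 := (harmonicAt_fderiv_apply hy hy3 v).2.self_of_nhds
  have h2 := (hy3.fderiv_right (m := 2) (by norm_num)).laplacian_CLM_comp_left
    (l := ContinuousLinearMap.apply ℝ F v)
  simp only [Function.comp_def, ContinuousLinearMap.apply_apply] at h2
  rw [h2] at h1
  exact h1

/-! ### The maximum principle -/

/-- The second derivative is nonpositive at a local maximum. -/
theorem IsLocalMax.deriv_deriv_nonpos {g : ℝ → ℝ} {a : ℝ} (h : IsLocalMax g a)
    (hc : ContinuousAt g a) : deriv (deriv g) a ≤ 0 := by
  by_contra! hpos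
  -- A point that is both a local maximum and a local minimum has g locally constant around it,
  -- contradicting `hpos`.
  have hmin := isLocalMin_of_deriv_deriv_pos hpos h.deriv_eq_zero hc
  have heq : g =ᶠ[nhds a] fun _ => g a := by
    filter_upwards [h, hmin] with t h1 h2
    exact le_antisymm h1 h2
  rw [heq.deriv.deriv_eq] at hpos
  simp at hpos

theorem deriv_deriv_line {f : E4 → ℝ} {x : E4} (hf : ContDiffAt ℝ 2 f x) (v : E4) :
    deriv (deriv fun t : ℝ => f (x + t • v)) 0 = fderiv ℝ (fun y => fderiv ℝ f y v) x v := by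
  have hline : ∀ t : ℝ, HasDerivAt (fun t : ℝ => x + t • v) v t := fun t => by
    simpa using ((hasDerivAt_id t).smul_const v).const_add x
  have hc : Filter.Tendsto (fun t : ℝ => x + t • v) (nhds 0) (nhds x) := by
    simpa using (hline 0).continuousAt.tendsto
  have h1 : deriv (fun t : ℝ => f (x + t • v)) =ᶠ[nhds 0] fun t => fderiv ℝ f (x + t • v) v := by
    filter_upwards [hc.eventually (hf.eventually (by simp))] with t ht
    exact ((ht.differentiableAt (by simp)).hasFDerivAt.comp_hasDerivAt t (hline t)).deriv
  rw [h1.deriv_eq]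
  have hd : DifferentiableAt ℝ (fun y => fderiv ℝ f y v) x :=
    ((hf.fderiv_right (m := 1) (by norm_num)).clm_apply contDiffAt_const).differentiableAt (by simp)
  have h2 : HasFDerivAt (fun y => fderiv ℝ f y v) (fderiv ℝ (fun y => fderiv ℝ f y v) x)
      (x + (0 : ℝ) • v) := by simpa using hd.hasFDerivAt
  exact (h2.comp_hasDerivAt (0 : ℝ) (hline 0)).deriv

/-- Adding ε|x|² makes the Laplacian equal to 8ε > 0, which excludes an interior maximum. The
maximum is then on the sphere, where the perturbed function equals ε, and ε is arbitrary. -/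
theorem InnerProductSpace.HarmonicContOnCl.nonpos_of_sphere {f : E4 → ℝ} (hf : HarmonicContOnCl f B4)
    (hs : ∀ x ∈ sphere (0 : E4) 1, f x = 0) : ∀ x ∈ closedBall (0 : E4) 1, f x ≤ 0 := by
  intro x hx
  refine le_of_forall_pos_le_add fun ε hε => ?_
  have hfc : ContinuousOn f (closedBall (0 : E4) 1) := hf.continuousOn_ball
  let g : E4 → ℝ := fun y => f y + ε * ‖y‖ ^ 2
  have hgc : ContinuousOn g (closedBall (0 : E4) 1) := hfc.add (by fun_prop)
  obtain ⟨z, hz, hmax⟩ := (isCompact_closedBall (0 : E4) 1).exists_isMaxOn ⟨x, hx⟩ hgc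
  have hzs : ‖z‖ = 1 := by
    by_contra hne
    have hzb : z ∈ B4 := by
      have : ‖z‖ ≤ 1 := by simpa using hz
      simpa using lt_of_le_of_ne this hne
    have hlm : IsLocalMax g z := by
      filter_upwards [isOpen_ball.mem_nhds hzb] with y hy
      exact hmax (ball_subset_closedBall hy)
    have hf2 : ContDiffAt ℝ 2 f z := hf.contDiffAt hzb
    have hg2 : ContDiffAt ℝ 2 g z :=
      hf2.add (contDiffAt_const.mul (contDiff_norm_sq ℝ).contDiffAt)
    have hle : ∀ i, fderiv ℝ (fun y => fderiv ℝ g y (stdVec i)) z (stdVec i) ≤ 0 := fun i => by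
      rw [← deriv_deriv_line hg2]
      have hcl : ContinuousAt (fun t : ℝ => z + t • stdVec i) 0 := by fun_prop
      refine IsLocalMax.deriv_deriv_nonpos ?_ ?_
      · have ht : Filter.Tendsto (fun t : ℝ => z + t • stdVec i) (nhds 0) (nhds z) := by
          simpa using hcl.tendsto
        filter_upwards [ht.eventually hlm] with t ht
        simpa using ht
      · refine ContinuousAt.comp (g := g) ?_ hcl
        simpa using hg2.continuousAt
    have heq : ∀ i, fderiv ℝ (fun y => fderiv ℝ g y (stdVec i)) z (stdVec i) =
        fderiv ℝ (fun y => fderiv ℝ f y (stdVec i)) z (stdVec i) + ε * 2 := fun i => by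
      have h1 : (fun y => fderiv ℝ g y (stdVec i)) =ᶠ[nhds z]
          fun y => fderiv ℝ f y (stdVec i) + ε * (2 * y i) := by
        filter_upwards [hf2.eventually (by simp)] with y hy
        have hn : DifferentiableAt ℝ (fun y : E4 => ‖y‖ ^ 2) y :=
          (contDiff_norm_sq ℝ (n := 1)).differentiable (by simp) y
        have : fderiv ℝ g y = _ := fderiv_add (hy.differentiableAt (by simp)) (hn.const_mul ε)
        rw [this, fderiv_const_mul hn]
        simp only [add_apply, smul_apply, smul_eq_mul, fderiv_norm_sq_stdVec]
      have hd : DifferentiableAt ℝ (fun y => fderiv ℝ f y (stdVec i)) z :=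
        ((hf2.fderiv_right (m := 1) (by norm_num)).clm_apply
          contDiffAt_const).differentiableAt (by simp)
      have hp : HasFDerivAt (fun y : E4 => ε * (2 * y i))
          (ε • (2 : ℝ) • (EuclideanSpace.proj i : E4 →L[ℝ] ℝ)) z :=
        (((EuclideanSpace.proj i : E4 →L[ℝ] ℝ).hasFDerivAt).const_mul 2).const_mul ε
      have hadd : fderiv ℝ (fun y => fderiv ℝ f y (stdVec i) + ε * (2 * y i)) z = _ :=
        (hd.hasFDerivAt.add hp).fderiv
      rw [h1.fderiv_eq, hadd]
      simp [stdVec_apply]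
    have hsum := Finset.sum_nonpos fun i (_ : i ∈ Finset.univ) => hle i
    rw [Finset.sum_congr rfl fun i _ => heq i, Finset.sum_add_distrib,
      ← laplacian_eq_sum_stdVec hf2, (hf.harmonicOnNhd z hzb).2.self_of_nhds] at hsum
    simp at hsum
    linarith
  have h1 : g x ≤ g z := hmax hx
  have h2 := hs z (by simpa using hzs)
  simp only [g, h2, hzs] at h1
  nlinarith [mul_nonneg hε.le (sq_nonneg ‖x‖)]

/-- Uniqueness for the Dirichlet problem of the Laplacian on the unit ball. -/
theorem InnerProductSpace.HarmonicContOnCl.eq_zero_of_sphere {f : E4 → ℝ} (hf : HarmonicContOnCl f B4)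
    (hs : ∀ x ∈ sphere (0 : E4) 1, f x = 0) : ∀ x ∈ closedBall (0 : E4) 1, f x = 0 := by
  intro x hx
  refine le_antisymm (hf.nonpos_of_sphere hs x hx) ?_
  have := hf.neg.nonpos_of_sphere (fun x hx => by simp [hs x hx]) x hx
  simpa using this

/-! ### The Kelvin transform of (x - p)/|x - p|⁴ -/

/-- The denominator `1 - 2⟨p, x⟩ + |p|²|x|²` of the Kelvin transform of `|x - p|⁻²`. -/
def kelvinDenom (p x : E4) : ℝ := 1 - 2 * inner ℝ p x + ‖p‖ ^ 2 * ‖x‖ ^ 2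

/-- The Kelvin transform of the vector field `(x - p) / |x - p|⁴`. -/
def kelvinField (p x : E4) : E4 := (kelvinDenom p x ^ 2)⁻¹ • (x - ‖x‖ ^ 2 • p)

/-- By Cauchy–Schwarz the denominator is at least (1 - |p||x|)², and |p||x| < 1. -/
theorem kelvinDenom_pos {p x : E4} (hp : p ∈ B4) (hx : x ∈ closedBall (0 : E4) 1) :
    0 < kelvinDenom p x := by
  have hp : ‖p‖ < 1 := by simpa using hp
  have hx : ‖x‖ ≤ 1 := by simpa using hx
  have h1 := real_inner_le_norm p x
  have h2 : ‖p‖ * ‖x‖ < 1 := by nlinarith [norm_nonneg p, norm_nonneg x]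
  unfold kelvinDenom
  nlinarith [sq_nonneg (1 - ‖p‖ * ‖x‖)]

theorem contDiff_kelvinDenom (p : E4) : ContDiff ℝ ∞ (kelvinDenom p) := by
  exact (contDiff_const.sub (contDiff_const.mul (contDiff_const.inner ℝ contDiff_id))).add
    (contDiff_const.mul (contDiff_norm_sq ℝ))

theorem contDiffAt_kelvinField {p x : E4} (h : kelvinDenom p x ≠ 0) :
    ContDiffAt ℝ ∞ (kelvinField p) x := by
  have h1 := (contDiff_kelvinDenom p).contDiffAt (x := x)
  have h2 := (contDiff_norm_sq ℝ (E := E4) (n := ∞)).contDiffAt (x := x)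
  exact ((h1.pow 2).inv (by positivity)).smul (contDiffAt_id.sub (h2.smul contDiffAt_const))

/-- For |x| = 1 the denominator is |x - p|². The Kelvin field thus has the prescribed boundary
values without the singularity at p. -/
theorem kelvinField_of_mem_sphere (p : E4) {x : E4} (hx : x ∈ sphere (0 : E4) 1) :
    kelvinField p x = (‖x - p‖ ^ 4)⁻¹ • (x - p) := by
  have hx : ‖x‖ = 1 := by simpa using hx
  have : kelvinDenom p x = ‖x - p‖ ^ 2 := by
    rw [norm_sub_sq_real, kelvinDenom, hx, real_inner_comm]; ring
  rw [kelvinField, this, hx, ← pow_mul]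
  simp

theorem kelvinDenom_line (p x : E4) (i : Fin 4) (t : ℝ) :
    kelvinDenom p (x + t • stdVec i) =
      kelvinDenom p x + t * (2 * ‖p‖ ^ 2 * x i - 2 * p i) + t ^ 2 * ‖p‖ ^ 2 := by
  simp only [kelvinDenom, norm_add_sq_real, inner_add_right, inner_smul_right, norm_smul, mul_pow]
  simp [stdVec, EuclideanSpace.inner_single_right]
  ring

theorem kelvinField_apply (p x : E4) (k : Fin 4) :
    kelvinField p x k = (x k - ‖x‖ ^ 2 * p k) / kelvinDenom p x ^ 2 := by
  simp [kelvinField, div_eq_inv_mul]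

theorem norm_sq_line (x : E4) (i : Fin 4) (t : ℝ) :
    ‖x + t • stdVec i‖ ^ 2 = ‖x‖ ^ 2 + 2 * t * x i + t ^ 2 := by
  rw [norm_add_sq_real, inner_smul_right, norm_smul, mul_pow]
  simp [stdVec, EuclideanSpace.inner_single_right]
  ring

/-- Reduces partial derivatives to one variable; along coordinate lines the Kelvin numerator and
denominator are quadratic polynomials in t. -/
theorem fderiv_apply_of_line {f : E4 → ℝ} {x v : E4} {c : ℝ} (hf : DifferentiableAt ℝ f x)
    (h : HasDerivAt (fun t : ℝ => f (x + t • v)) c 0) : fderiv ℝ f x v = c := by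
  have hline : HasDerivAt (fun t : ℝ => x + t • v) v 0 := by
    simpa using ((hasDerivAt_id (0 : ℝ)).smul_const v).const_add x
  have h2 : HasFDerivAt f (fderiv ℝ f x) (x + (0 : ℝ) • v) := by simpa using hf.hasFDerivAt
  exact (h2.comp_hasDerivAt (0 : ℝ) hline).unique h

theorem hasDerivAt_kelvinDenom_line (p x : E4) (i : Fin 4) :
    HasDerivAt (fun t : ℝ => kelvinDenom p (x + t • stdVec i))
      (2 * ‖p‖ ^ 2 * x i - 2 * p i) 0 := by
  simp only [kelvinDenom_line]
  have h1 := ((hasDerivAt_id (0 : ℝ)).mul_const (2 * ‖p‖ ^ 2 * x i - 2 * p i)).const_add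
    (kelvinDenom p x)
  have h2 := ((hasDerivAt_id (0 : ℝ)).pow 2).mul_const (‖p‖ ^ 2)
  exact (h1.add h2).congr_deriv (by simp)

theorem hasDerivAt_kelvinNum_line (p x : E4) (i k : Fin 4) :
    HasDerivAt (fun t : ℝ => (x + t • stdVec i) k - ‖x + t • stdVec i‖ ^ 2 * p k)
      (stdVec i k - 2 * x i * p k) 0 := by
  simp only [norm_sq_line]
  have h1 := ((hasDerivAt_id (0 : ℝ)).mul_const (stdVec i k)).const_add (x k)
  have h2 := (((hasDerivAt_id (0 : ℝ)).const_mul 2).mul_const (x i)).const_add (‖x‖ ^ 2)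
  have h3 := (h2.add ((hasDerivAt_id (0 : ℝ)).pow 2)).mul_const (p k)
  exact (h1.sub h3).congr_deriv (by simp)

/-- The numerator of the partial derivatives of the Kelvin field. -/
def kelvinDerivNum (p x : E4) (i k : Fin 4) : ℝ :=
  (stdVec i k - 2 * x i * p k) * kelvinDenom p x -
    2 * (x k - ‖x‖ ^ 2 * p k) * (2 * ‖p‖ ^ 2 * x i - 2 * p i)

theorem fderiv_kelvinField_apply {p x : E4} (h : kelvinDenom p x ≠ 0) (i k : Fin 4) :
    fderiv ℝ (fun y => kelvinField p y k) x (stdVec i) =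
      kelvinDerivNum p x i k / kelvinDenom p x ^ 3 := by
  refine fderiv_apply_of_line ?_ ?_
  · exact (((EuclideanSpace.proj k : E4 →L[ℝ] ℝ).contDiff.contDiffAt).comp x
      (contDiffAt_kelvinField h)).differentiableAt (by simp)
  · simp only [kelvinField_apply]
    have hD := hasDerivAt_kelvinDenom_line p x i
    have hN := hasDerivAt_kelvinNum_line p x i k
    refine (hN.div (hD.pow 2) (by simpa using h)).congr_deriv ?_
    simp [kelvinDerivNum]
    field_simp

theorem fderiv_kelvinDeriv {p x : E4} (h : kelvinDenom p x ≠ 0) (i k : Fin 4) :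
    fderiv ℝ (fun y => kelvinDerivNum p y i k / kelvinDenom p y ^ 3) x (stdVec i) =
      ((-2 * p k) * kelvinDenom p x +
        (stdVec i k - 2 * x i * p k) * (2 * ‖p‖ ^ 2 * x i - 2 * p i)
        - 2 * (stdVec i k - 2 * x i * p k) * (2 * ‖p‖ ^ 2 * x i - 2 * p i)
        - 2 * (x k - ‖x‖ ^ 2 * p k) * (2 * ‖p‖ ^ 2)) / kelvinDenom p x ^ 3
      - 3 * kelvinDerivNum p x i k * (2 * ‖p‖ ^ 2 * x i - 2 * p i) / kelvinDenom p x ^ 4 := by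
  have hD := hasDerivAt_kelvinDenom_line p x i
  have hN := hasDerivAt_kelvinNum_line p x i k
  have hX : HasDerivAt (fun t : ℝ => (x + t • stdVec i) i) 1 0 := by
    have := ((hasDerivAt_id (0 : ℝ)).mul_const (stdVec i i)).const_add (x i)
    simpa [stdVec_apply] using this
  refine fderiv_apply_of_line ?_ ?_
  · have h1 := (contDiff_kelvinDenom p).differentiable (by simp) x
    have h2 : DifferentiableAt ℝ (fun y : E4 => ‖y‖ ^ 2) x :=
      (contDiff_norm_sq ℝ (n := 1)).differentiable (by simp) x
    have h3 : ∀ j, DifferentiableAt ℝ (fun y : E4 => y j) x := fun j =>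
      (EuclideanSpace.proj j : E4 →L[ℝ] ℝ).differentiableAt
    unfold kelvinDerivNum
    fun_prop (disch := exact pow_ne_zero _ h)
  · unfold kelvinDerivNum
    have hA := ((hX.const_mul 2).mul_const (p k)).const_sub (stdVec i k)
    have hB := (hX.const_mul (2 * ‖p‖ ^ 2)).sub_const (2 * p i)
    refine (((hA.mul hD).sub ((hN.const_mul 2).mul hB)).div (hD.pow 3)
      (pow_ne_zero 3 (by simpa using h))).congr_deriv ?_
    simp
    field_simp
    ring

theorem harmonicAt_kelvinField {p x : E4} (h : kelvinDenom p x ≠ 0) :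
    HarmonicAt (kelvinField p) x := by
  refine ⟨(contDiffAt_kelvinField h).of_le ENat.LEInfty.out, ?_⟩
  have hev : ∀ᶠ y in nhds x, kelvinDenom p y ≠ 0 :=
    (contDiff_kelvinDenom p).continuous.continuousAt.eventually_ne h
  filter_upwards [hev.eventually_nhds] with y hy
  have hy0 := hy.self_of_nhds
  have hcd : ContDiffAt ℝ 2 (kelvinField p) y := (contDiffAt_kelvinField hy0).of_le ENat.LEInfty.out
  ext k
  have h2 := hcd.laplacian_CLM_comp_left (l := (EuclideanSpace.proj k : E4 →L[ℝ] ℝ))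
  change _ = Laplacian.laplacian (kelvinField p) y k at h2
  rw [← h2, laplacian_eq_sum_stdVec
    (((EuclideanSpace.proj k : E4 →L[ℝ] ℝ).contDiff.contDiffAt).comp y hcd)]
  have hterm : ∀ i, fderiv ℝ (fun z => fderiv ℝ (fun y => kelvinField p y k) z (stdVec i)) y
      (stdVec i) = _ := fun i => by
    refine Eq.trans ?_ (fderiv_kelvinDeriv hy0 i k)
    congr 1
    refine Filter.EventuallyEq.fderiv_eq ?_
    filter_upwards [hy] with z hz
    exact fderiv_kelvinField_apply hz i k
  change ∑ i, fderiv ℝ (fun z => fderiv ℝ (fun y => kelvinField p y k) z (stdVec i)) y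
    (stdVec i) = 0
  rw [Finset.sum_congr rfl fun i _ => hterm i]
  have hD : kelvinDenom p y = 1 - 2 * (∑ j, y j * p j) + (∑ j, p j ^ 2) * (∑ j, y j ^ 2) := by
    simp [kelvinDenom, EuclideanSpace.real_norm_sq_eq, PiLp.inner_apply]
  have hp : ‖p‖ ^ 2 = ∑ j, p j ^ 2 := EuclideanSpace.real_norm_sq_eq p
  have hyn : ‖y‖ ^ 2 = ∑ j, y j ^ 2 := EuclideanSpace.real_norm_sq_eq y
  simp only [kelvinDerivNum, hp, hyn]
  simp only [Fin.sum_univ_four] at hD ⊢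
  -- The denominator is kept as a nonzero symbol while fractions are cleared. Its coordinate
  -- expression is needed only for the resulting polynomial identity.
  generalize kelvinDenom p y = D at hy0 hD
  field_simp
  subst hD
  fin_cases k <;> simp [stdVec_apply] <;> ring

/-! ### The harmonic potential h_p: explicit form and uniqueness -/

@[simp] theorem dx_apply (i : Fin 4) (v : Fin 1 → E4) : dx i v = v 0 i := by
  simp [dx]

/-- Components of a covector determine the real linear functional. -/
theorem oneForm_ext {α β : E4 [⋀^Fin 1]→L[ℝ] ℝ} (h : ∀ v, α ![v] = β ![v]) : α = β := by
  ext w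
  have : w = ![w 0] := by ext i; fin_cases i; rfl
  rw [this]; exact h _

/-- Evaluation of covectors at a vector. -/
def evalOne (v : E4) : (E4 [⋀^Fin 1]→L[ℝ] ℝ) →L[ℝ] ℝ :=
  ContinuousAlternatingMap.apply ℝ E4 ℝ ![v]

theorem evalOne_apply (v : E4) (α : E4 [⋀^Fin 1]→L[ℝ] ℝ) : evalOne v α = α ![v] := rfl

/-- The `Im ℍ`-valued covectors `v ↦ Im (w̄ v)`, by components, as linear maps in `w`. -/
def imConjMul : Fin 3 → E4 →L[ℝ] E4 [⋀^Fin 1]→L[ℝ] ℝ :=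
  let π (i : Fin 4) : E4 →L[ℝ] ℝ := EuclideanSpace.proj i
  ![(π 0).smulRight (dx 1) - (π 1).smulRight (dx 0) - (π 2).smulRight (dx 3)
      + (π 3).smulRight (dx 2),
    (π 0).smulRight (dx 2) - (π 2).smulRight (dx 0) - (π 3).smulRight (dx 1)
      + (π 1).smulRight (dx 3),
    (π 0).smulRight (dx 3) - (π 3).smulRight (dx 0) - (π 1).smulRight (dx 2)
      + (π 2).smulRight (dx 1)]

theorem imConjMul_apply (l : Fin 3) (w v : E4) :
    imConjMul l w ![v] = imCoord (star (toQuat w) * toQuat v) l := by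
  have h1 : (star (toQuat w)).re = w 0 := Quaternion.re_star _
  have h2 : (star (toQuat w)).imI = -w 1 := Quaternion.imI_star _
  have h3 : (star (toQuat w)).imJ = -w 2 := Quaternion.imJ_star _
  have h4 : (star (toQuat w)).imK = -w 3 := Quaternion.imK_star _
  fin_cases l <;> simp [imConjMul, imCoord, Quaternion.imI_mul, Quaternion.imJ_mul,
    Quaternion.imK_mul, h1, h2, h3, h4] <;> simp [toQuat] <;> ring

/-- The explicit harmonic potential `h_p`. -/
def kelvinPotential (p : E4) : LieOneForm := fun l x => imConjMul l (kelvinField p x)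

theorem harmonicOnNhd_kelvinField {p : E4} (hp : p ∈ B4) :
    HarmonicOnNhd (kelvinField p) (closedBall (0 : E4) 1) := fun _ hx =>
  harmonicAt_kelvinField (kelvinDenom_pos hp hx).ne'

theorem isHarmonicPotential_kelvinPotential {p : E4} (hp : p ∈ B4) :
    IsHarmonicPotential p (kelvinPotential p) := by
  refine ⟨fun l => ?_, fun l x hx v => ?_⟩
  · have h := (harmonicOnNhd_kelvinField hp).comp_CLM (imConjMul l)
    exact HarmonicContOnCl.mk_ball (h.mono ball_subset_closedBall) h.continuousOn
  · rw [← imConjMul_apply, kelvinPotential, kelvinField_of_mem_sphere p hx, map_smul]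
    simp [div_eq_inv_mul]

theorem IsHarmonicPotential.eqOn {p : E4} {h h' : LieOneForm} (hh : IsHarmonicPotential p h)
    (hh' : IsHarmonicPotential p h') (l : Fin 3) : Set.EqOn (h l) (h' l) (closedBall 0 1) := by
  intro x hx
  refine oneForm_ext fun v => ?_
  let L := evalOne v
  have hL : ∀ α, L α = α ![v] := fun α => evalOne_apply v α
  have hd := (hh.harmonic l).sub (hh'.harmonic l)
  have hd' : HarmonicContOnCl (L ∘ (h l - h' l)) B4 :=
    ⟨hd.harmonicOnNhd.comp_CLM L, L.continuous.comp_continuousOn hd.continuousOn⟩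
  have := hd'.eq_zero_of_sphere (fun y hy => by
    simp [hL, hh.boundary l y hy v, hh'.boundary l y hy v]) x hx
  simpa [hL, sub_eq_zero] using this

/-! ### Curvature and the anti-self-dual pairing -/

theorem curv_apply (A : OneForm) (x : E4) (i j : Fin 4) :
    curv A x i j = fderiv ℝ A x (stdVec i) ![stdVec j] - fderiv ℝ A x (stdVec j) ![stdVec i] := by
  have h : Fin.removeNth 1 ![stdVec i, stdVec j] = ![stdVec i] := by
    ext k; fin_cases k; rfl
  simp [curv, twoFormCoeff, extDeriv, ContinuousAlternatingMap.alternatizeUncurryFin_apply,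
    Fin.sum_univ_two, h, sub_eq_add_neg]

theorem twoFormInner_asdPart (F H : Matrix (Fin 4) (Fin 4) ℝ) :
    twoFormInner (asdPart F) (asdPart H) = 1 / 2 * ((F 0 1 - F 2 3) * (H 0 1 - H 2 3) +
      (F 0 2 + F 1 3) * (H 0 2 + H 1 3) + (F 0 3 - F 1 2) * (H 0 3 - H 1 2)) := by
  simp [twoFormInner, asdPart, hodgeStar, Fin.sum_univ_four]
  ring

/-- The alternation of `T ↦ Im (T̄ dx)`, the components of `d (Im (f̄ dx))` for `T = Df`. -/
def conjMulCurv (l : Fin 3) (T : E4 →L[ℝ] E4) : Matrix (Fin 4) (Fin 4) ℝ :=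
  Matrix.of fun i j => imConjMul l (T (stdVec i)) ![stdVec j] -
    imConjMul l (T (stdVec j)) ![stdVec i]

theorem curv_kelvinPotential {p : E4} (hp : p ∈ B4) {x : E4} (hx : x ∈ closedBall (0 : E4) 1)
    (l : Fin 3) : curv (kelvinPotential p l) x = conjMulCurv l (fderiv ℝ (kelvinField p) x) := by
  have hd : DifferentiableAt ℝ (kelvinField p) x :=
    (contDiffAt_kelvinField (kelvinDenom_pos hp hx).ne').differentiableAt (by simp)
  have h : HasFDerivAt (kelvinPotential p l) _ x := (imConjMul l).hasFDerivAt.comp x hd.hasFDerivAt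
  ext i j
  rw [curv_apply, h.fderiv]
  rfl

/-- The pairing of a constant form with the anti-self-dual part of `conjMulCurv`. -/
def asdPairing (F : Matrix (Fin 4) (Fin 4) ℝ) (l : Fin 3) : (E4 →L[ℝ] E4) →L[ℝ] ℝ :=
  LinearMap.toContinuousLinearMap
    { toFun := fun T => twoFormInner (asdPart F) (asdPart (conjMulCurv l T))
      map_add' := fun T S => by
        simp only [twoFormInner_asdPart, conjMulCurv, Matrix.of_apply, add_apply, map_add,
          ContinuousAlternatingMap.add_apply]
        ring
      map_smul' := fun c T => by
        simp only [twoFormInner_asdPart, conjMulCurv, Matrix.of_apply, smul_apply, map_smul,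
          ContinuousAlternatingMap.smul_apply, smul_eq_mul, RingHom.id_apply]
        ring }

theorem asdPairing_apply (F : Matrix (Fin 4) (Fin 4) ℝ) (l : Fin 3) (T : E4 →L[ℝ] E4) :
    asdPairing F l T = twoFormInner (asdPart F) (asdPart (conjMulCurv l T)) := rfl

/-- The field is x + O(|x|²) at the origin for every p, which is why the linear part of the boundary
matrix does not depend on p. -/
theorem fderiv_kelvinField_zero (p : E4) :
    fderiv ℝ (kelvinField p) 0 = ContinuousLinearMap.id ℝ E4 := by
  have h0 : kelvinDenom p 0 = 1 := by simp [kelvinDenom]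
  have hd : DifferentiableAt ℝ (kelvinField p) 0 :=
    (contDiffAt_kelvinField (by simp [h0])).differentiableAt (by simp)
  ext v k
  have h : HasFDerivAt (fun y => kelvinField p y k)
      ((EuclideanSpace.proj k : E4 →L[ℝ] ℝ).comp (fderiv ℝ (kelvinField p) 0)) 0 :=
    (EuclideanSpace.proj k : E4 →L[ℝ] ℝ).hasFDerivAt.comp 0 hd.hasFDerivAt
  have h1 : fderiv ℝ (kelvinField p) 0 v k = fderiv ℝ (fun y => kelvinField p y k) 0 v := by
    rw [h.fderiv]; rfl
  rw [h1, fderiv_eq_sum_stdVec]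
  simp [fderiv_kelvinField_apply (p := p) (x := 0) (by simp [h0]), kelvinDerivNum, h0,
    stdVec_apply]

/-- The potentials `β_k⁻` as linear maps. -/
def asdPotentialCLM : Fin 3 → E4 →L[ℝ] E4 [⋀^Fin 1]→L[ℝ] ℝ :=
  let π (i : Fin 4) : E4 →L[ℝ] ℝ := EuclideanSpace.proj i
  ![(π 0).smulRight (dx 1) - (π 2).smulRight (dx 3),
    (π 0).smulRight (dx 2) + (π 1).smulRight (dx 3),
    (π 0).smulRight (dx 3) - (π 1).smulRight (dx 2)]

theorem asdPotential_eq (k : Fin 3) : asdPotential k = asdPotentialCLM k := by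
  funext x
  fin_cases k <;> simp [asdPotential, asdPotentialCLM]

/-- The constant components of `dβ_k⁻`. -/
def asdBasis (k : Fin 3) : Matrix (Fin 4) (Fin 4) ℝ :=
  Matrix.of fun i j => asdPotentialCLM k (stdVec i) ![stdVec j] -
    asdPotentialCLM k (stdVec j) ![stdVec i]

/-- For T = id the form d Im(x̄ dx) has l-th component 2 dβ_l⁻, and the dβ_k⁻ are orthogonal of
squared norm 2. -/
theorem asdPairing_asdBasis_id (k l : Fin 3) :
    asdPairing (asdBasis k) l (ContinuousLinearMap.id ℝ E4) = if k = l then 4 else 0 := by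
  rw [asdPairing_apply, twoFormInner_asdPart]
  fin_cases k <;> fin_cases l <;>
    simp [asdBasis, conjMulCurv, asdPotentialCLM, imConjMul, stdVec_apply] <;> norm_num

/-- For constant F the integrand is a fixed linear functional of the derivative of a harmonic field,
so the mean value property applies. -/
theorem integral_asdPairing {p : E4} (hp : p ∈ B4) (F : Matrix (Fin 4) (Fin 4) ℝ) (l : Fin 3) :
    ∫ x in B4, twoFormInner (asdPart F) (asdPart (curv (kelvinPotential p l) x)) =
      (volume B4).toReal * asdPairing F l (ContinuousLinearMap.id ℝ E4) := by
  have hharm : HarmonicOnNhd (fun x => asdPairing F l (fderiv ℝ (kelvinField p) x))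
      (closedBall (0 : E4) 1) := fun x hx =>
    (harmonicAt_fderiv (harmonicOnNhd_kelvinField hp x hx)
      ((contDiffAt_kelvinField (kelvinDenom_pos hp hx).ne').of_le ENat.LEInfty.out)).comp_CLM _
  rw [← fderiv_kelvinField_zero p, ← integral_ball_eq_of_harmonicOnNhd hharm]
  refine setIntegral_congr_fun measurableSet_ball fun x hx => ?_
  simp only [asdPairing_apply, curv_kelvinPotential hp (ball_subset_closedBall hx)]

/-! ### Integrability and the energy argument -/

/-- Measurable and essentially bounded on the ball. -/
abbrev BddOnBall (f : E4 → ℝ) : Prop := MemLp f ⊤ (volume.restrict B4)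

theorem bddOnBall_of_continuousOn {f : E4 → ℝ} (hf : ContinuousOn f B4) {C : ℝ}
    (hC : ∀ x ∈ B4, |f x| ≤ C) : BddOnBall f :=
  memLp_top_of_bound (hf.aestronglyMeasurable measurableSet_ball) C
    ((ae_restrict_iff' measurableSet_ball).2 (Filter.Eventually.of_forall hC))

theorem BddOnBall.integrableOn {f : E4 → ℝ} (hf : BddOnBall f) : IntegrableOn f B4 :=
  have : IsFiniteMeasure (volume.restrict B4) := ⟨by simp [measure_ball_lt_top]⟩
  hf.integrable le_top

theorem bddOnBall_asd {F H : E4 → Matrix (Fin 4) (Fin 4) ℝ}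
    (hF : ∀ i j, BddOnBall fun x => F x i j) (hH : ∀ i j, BddOnBall fun x => H x i j) :
    BddOnBall fun x => twoFormInner (asdPart (F x)) (asdPart (H x)) := by
  simp only [twoFormInner_asdPart]
  have hmul : ∀ {f g : E4 → ℝ}, BddOnBall f → BddOnBall g → BddOnBall fun x => f x * g x :=
    fun hf hg => hg.mul' hf
  exact ((((hmul ((hF 0 1).sub (hF 2 3)) ((hH 0 1).sub (hH 2 3))).add
    (hmul ((hF 0 2).add (hF 1 3)) ((hH 0 2).add (hH 1 3)))).add
    (hmul ((hF 0 3).sub (hF 1 2)) ((hH 0 3).sub (hH 1 2))))).const_mul _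

theorem bddOnBall_curv_kelvinPotential {p : E4} (hp : p ∈ B4) (l : Fin 3) (i j : Fin 4) :
    BddOnBall fun x => curv (kelvinPotential p l) x i j := by
  have hc : ContinuousOn (fun x => curv (kelvinPotential p l) x i j) (closedBall (0 : E4) 1) := by
    have h1 : ContinuousOn (fun x => fderiv ℝ (kelvinField p) x) (closedBall (0 : E4) 1) :=
      fun x hx => (((contDiffAt_kelvinField (kelvinDenom_pos hp hx).ne').fderiv_right
        (m := 1) (by rw [one_add_one_eq_two]; exact ENat.LEInfty.out)).continuousAt).continuousWithinAt
    have h2 : ∀ a b : Fin 4, ContinuousOn (fun x => evalOne (stdVec b)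
        (imConjMul l (fderiv ℝ (kelvinField p) x (stdVec a)))) (closedBall (0 : E4) 1) :=
      fun a b => ((evalOne (stdVec b)).comp (imConjMul l)).continuous.comp_continuousOn
        (h1.clm_apply continuousOn_const)
    exact ((h2 i j).sub (h2 j i)).congr fun x hx => by
      rw [curv_kelvinPotential hp hx]; rfl
  obtain ⟨C, hC⟩ := (isCompact_closedBall (0 : E4) 1).exists_bound_of_continuousOn hc
  exact bddOnBall_of_continuousOn (hc.mono ball_subset_closedBall) fun x hx =>
    hC x (ball_subset_closedBall hx)

/-- Energy uniqueness: a `1`-form with components `C` on the unit ball whose curvature `F` is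
coclosed and whose tangential part vanishes on the sphere has `F = 0`. -/
theorem ae_curl_eq_zero {C : Fin 4 → E4 → ℝ} (hC : ∀ j, ContDiffOn ℝ 2 (C j) B4) {K : NNReal}
    (hL : ∀ j, LipschitzOnWith K (C j) (closedBall 0 1)) {F : Fin 4 → Fin 4 → E4 → ℝ}
    (hF : ∀ i j x, F i j x = fderiv ℝ (C j) x (stdVec i) - fderiv ℝ (C i) x (stdVec j))
    (hdiv : ∀ x ∈ B4, ∀ j, ∑ i, fderiv ℝ (F i j) x (stdVec i) = 0)
    (htan : ∀ y ∈ sphere (0 : E4) 1, ∀ v : E4, inner ℝ y v = 0 → ∑ j, v j * C j y = 0) :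
    ∀ᵐ x ∂(volume.restrict B4), ∀ i j, F i j x = 0 := by
  have hcd : ∀ i j, ContDiffOn ℝ 1 (F i j) B4 := fun i j x hx => by
    have h : ∀ k w, ContDiffAt ℝ 1 (fun y => fderiv ℝ (C k) y w) x := fun k w =>
      (((hC k).contDiffAt (isOpen_ball.mem_nhds hx)).fderiv_right (m := 1)
        (by norm_num)).clm_apply contDiffAt_const
    have : F i j = fun x => fderiv ℝ (C j) x (stdVec i) - fderiv ℝ (C i) x (stdVec j) :=
      funext (hF i j)
    rw [this]
    exact ((h j _).sub (h i _)).contDiffWithinAt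
  have hskew : ∀ i j x, F i j x = -F j i x := fun i j x => by rw [hF, hF]; ring
  have hnorm : ∀ i, ‖stdVec i‖ = 1 := fun i => by simp [stdVec]
  have hpd : ∀ i j, ∀ x ∈ B4, |fderiv ℝ (C j) x (stdVec i)| ≤ K := fun i j x hx => by
    have h1 := norm_fderiv_le_of_lipschitzOn ℝ
      (Filter.mem_of_superset (isOpen_ball.mem_nhds hx) ball_subset_closedBall) (hL j)
    calc _ ≤ ‖fderiv ℝ (C j) x‖ * ‖stdVec i‖ := (fderiv ℝ (C j) x).le_opNorm _
      _ ≤ K := by rw [hnorm, mul_one]; exact h1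
  have hFb : ∀ i j, ∀ x ∈ B4, |F i j x| ≤ 2 * K := fun i j x hx => by
    rw [hF]
    have := (abs_sub _ _).trans (add_le_add (hpd i j x hx) (hpd j i x hx))
    linarith
  -- In div V the derivative of F drops out by coclosedness, and skewness turns ∑ F_ij ∂_i C_j into
  -- ½ ∑ F_ij².
  let V : Fin 4 → E4 → ℝ := fun i x => ∑ j, F i j x * C j x
  have hV : ∀ i, ContDiffOn ℝ 1 (V i) B4 := fun i =>
    ContDiffOn.sum fun j _ => (hcd i j).mul ((hC j).of_le (by norm_num))
  have hdivV : ∀ x ∈ B4, ∑ i, fderiv ℝ (V i) x (stdVec i) = ∑ i, ∑ j, F i j x ^ 2 / 2 := by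
    intro x hx
    have hFd : ∀ i j, DifferentiableAt ℝ (F i j) x := fun i j =>
      ((hcd i j).contDiffAt (isOpen_ball.mem_nhds hx)).differentiableAt (by simp)
    have hCd : ∀ j, DifferentiableAt ℝ (C j) x := fun j =>
      ((hC j).contDiffAt (isOpen_ball.mem_nhds hx)).differentiableAt (by simp)
    have hterm : ∀ i, fderiv ℝ (V i) x (stdVec i) =
        ∑ j, (fderiv ℝ (F i j) x (stdVec i) * C j x + F i j x * fderiv ℝ (C j) x (stdVec i)) :=
      fun i => by
        have : fderiv ℝ (V i) x = _ := fderiv_fun_sum fun j _ => (hFd i j).mul (hCd j)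
        rw [this, sum_apply]
        refine Finset.sum_congr rfl fun j _ => ?_
        rw [fderiv_fun_mul (hFd i j) (hCd j)]
        simp only [add_apply, smul_apply, smul_eq_mul]
        ring
    rw [Finset.sum_congr rfl fun i _ => hterm i]
    simp only [Finset.sum_add_distrib]
    have h1 : ∑ i, ∑ j, fderiv ℝ (F i j) x (stdVec i) * C j x = 0 := by
      rw [Finset.sum_comm]
      refine Finset.sum_eq_zero fun j _ => ?_
      rw [← Finset.sum_mul, hdiv x hx j, zero_mul]
    have h2 : ∑ i, ∑ j, F i j x * fderiv ℝ (C j) x (stdVec i) =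
        -∑ i, ∑ j, F i j x * fderiv ℝ (C i) x (stdVec j) := by
      rw [Finset.sum_comm, ← Finset.sum_neg_distrib]
      refine Finset.sum_congr rfl fun i _ => ?_
      rw [← Finset.sum_neg_distrib]
      exact Finset.sum_congr rfl fun j _ => by rw [hskew j i]; ring
    have h3 : ∑ i, ∑ j, F i j x ^ 2 / 2 = (∑ i, ∑ j, F i j x * fderiv ℝ (C j) x (stdVec i) -
        ∑ i, ∑ j, F i j x * fderiv ℝ (C i) x (stdVec j)) / 2 := by
      simp only [← Finset.sum_sub_distrib, Finset.sum_div]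
      refine Finset.sum_congr rfl fun i _ => Finset.sum_congr rfl fun j _ => ?_
      rw [← mul_sub, ← hF]; ring
    rw [h1, h3]
    linarith
  -- Contracting F with x gives a vector v, orthogonal to x by skewness, so the tangential condition
  -- at y = x/|x| gives ∑ v_j C_j(y) = 0. Replacing C(x) by C(x) - C(y) leaves 16 terms, each at
  -- most 2K · K(1 - |x|).
  have hbound : ∀ x ∈ B4, |∑ i, V i x * x i| ≤ (32 * K * K) * (1 - ‖x‖) := by
    intro x hx
    have hx1 : ‖x‖ < 1 := by simpa using hx
    have hKK : (0 : ℝ) ≤ 32 * K * K := by positivity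
    rcases eq_or_ne x 0 with rfl | hx0
    · simpa using hKK
    have hn : 0 < ‖x‖ := norm_pos_iff.2 hx0
    set y : E4 := ‖x‖⁻¹ • x with hy
    have hyn : ‖y‖ = 1 := by rw [hy, norm_smul, norm_inv, norm_norm, inv_mul_cancel₀ hn.ne']
    have hdist : dist x y = 1 - ‖x‖ := by
      have h1 : x - y = (1 - ‖x‖⁻¹) • x := by rw [hy, sub_smul, one_smul]
      have h2 : 1 - ‖x‖⁻¹ ≤ 0 := by
        have := (one_le_inv₀ hn).2 hx1.le
        linarith
      rw [dist_eq_norm, h1, norm_smul, Real.norm_eq_abs, abs_of_nonpos h2]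
      field_simp
      ring
    let v : E4 := WithLp.toLp 2 fun j => ∑ i, F i j x * x i
    have hvj : ∀ j, v j = ∑ i, F i j x * x i := fun j => rfl
    have hxv : inner ℝ x v = 0 := by
      have h1 : inner ℝ x v = ∑ i, ∑ j, F i j x * (x i * x j) := by
        rw [Finset.sum_comm]
        simp only [PiLp.inner_apply, hvj, RCLike.inner_apply, conj_trivial]
        refine Finset.sum_congr rfl fun j _ => ?_
        rw [Finset.sum_mul]
        exact Finset.sum_congr rfl fun i _ => by ring
      have h2 : ∑ i, ∑ j, F i j x * (x i * x j) = -∑ i, ∑ j, F i j x * (x i * x j) := by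
        conv_lhs => rw [Finset.sum_comm]
        simp only [← Finset.sum_neg_distrib]
        exact Finset.sum_congr rfl fun i _ => Finset.sum_congr rfl fun j _ => by
          rw [hskew j i]; ring
      linarith
    have hyv : inner ℝ y v = 0 := by rw [hy, inner_smul_left, hxv, mul_zero]
    have h0 := htan y (by simpa using hyn) v hyv
    have h1 : ∑ i, V i x * x i = ∑ j, ∑ i, F i j x * x i * (C j x - C j y) := by
      have : ∑ i, V i x * x i = ∑ j, v j * C j x := by
        simp only [V, hvj, Finset.sum_mul]
        rw [Finset.sum_comm]
        exact Finset.sum_congr rfl fun j _ => Finset.sum_congr rfl fun i _ => by ring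
      rw [this, ← sub_zero (∑ j, v j * C j x), ← h0, ← Finset.sum_sub_distrib]
      refine Finset.sum_congr rfl fun j _ => ?_
      rw [← mul_sub, hvj, Finset.sum_mul]
    rw [h1]
    have hterm : ∀ i j, |F i j x * x i * (C j x - C j y)| ≤ 2 * K * K * (1 - ‖x‖) := fun i j => by
      have hxi : |x i| ≤ 1 := (PiLp.norm_apply_le x i).trans hx1.le
      have hl := (hL j).dist_le_mul x (ball_subset_closedBall hx) y (by simp [hyn])
      rw [hdist, Real.dist_eq] at hl
      rw [abs_mul, abs_mul]
      calc _ ≤ 2 * K * 1 * (K * (1 - ‖x‖)) := by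
            gcongr
            exact hFb i j x hx
        _ = _ := by ring
    refine (Finset.abs_sum_le_sum_abs _ _).trans ?_
    refine (Finset.sum_le_sum fun j _ => (Finset.abs_sum_le_sum_abs _ _).trans
      (Finset.sum_le_sum fun i _ => hterm i j)).trans (le_of_eq ?_)
    simp
    ring
  have hbdd : ∀ i j, BddOnBall (F i j) := fun i j =>
    bddOnBall_of_continuousOn (hcd i j).continuousOn (hFb i j)
  have hint : IntegrableOn (fun x => ∑ i, ∑ j, F i j x ^ 2 / 2) B4 := by
    refine integrable_finsetSum _ fun i _ => integrable_finsetSum _ fun j _ => ?_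
    simp only [sq]
    have h : BddOnBall fun x => F i j x * F i j x := (hbdd i j).mul' (hbdd i j)
    exact h.integrableOn.div_const 2
  have hzero := integral_divergence_ball_eq_zero hV hbound
    (hint.congr_fun (fun x hx => (hdivV x hx).symm) measurableSet_ball)
  rw [setIntegral_congr_fun measurableSet_ball hdivV,
    integral_eq_zero_iff_of_nonneg (fun x => by positivity) hint] at hzero
  filter_upwards [hzero] with x hx i j
  simp only [Pi.zero_apply] at hx
  rw [Finset.sum_eq_zero_iff_of_nonneg (fun i _ => by positivity)] at hx
  have := (Finset.sum_eq_zero_iff_of_nonneg (fun j _ => by positivity)).1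
    (hx i (Finset.mem_univ i)) j (Finset.mem_univ j)
  simpa using this

/-! ### Extension from the sphere and tangential traces -/

/-- Smooth functions on the sphere extend smoothly to `ℝ⁴`. -/
theorem exists_contDiff_extension {ξ : S3 → ℝ} (hξ : ContMDiff (𝓡 3) 𝓘(ℝ, ℝ) ∞ ξ) :
    ∃ Ξ : E4 → ℝ, ContDiff ℝ ∞ Ξ ∧ ∀ y : S3, Ξ y = ξ y := by
  classical
  have hmem : ∀ x : E4, x ≠ 0 → ‖x‖⁻¹ • x ∈ sphere (0 : E4) 1 := fun x hx => by
    simp [norm_smul, norm_ne_zero_iff.2 hx]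
  let e : E4 → ℝ := fun x => if h : x ≠ 0 then ξ ⟨‖x‖⁻¹ • x, hmem x h⟩ else 0
  have he : ∀ x, x ≠ 0 → ContDiffAt ℝ ∞ e x := by
    intro x hx
    have hn : 0 < ‖x‖ := norm_pos_iff.2 hx
    let ρ : ContDiffBump x := ⟨‖x‖ / 4, ‖x‖ / 2, by positivity, by linarith⟩
    -- A smooth nowhere vanishing map equal to the identity near x. Its normalisation is a globally
    -- defined map into the sphere that agrees with z/|z| near x.
    let Φ : E4 → E4 := fun z => x + ρ z • (z - x)
    have hΦ0 : ∀ z, Φ z ≠ 0 := by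
      intro z hz
      have h1 : ‖ρ z • (z - x)‖ < ‖x‖ := by
        by_cases hzx : dist z x < ‖x‖ / 2
        · rw [norm_smul, Real.norm_of_nonneg ρ.nonneg, ← dist_eq_norm]
          nlinarith [ρ.le_one (x := z), ρ.nonneg (x := z), dist_nonneg (x := z) (y := x)]
        · rw [ρ.zero_of_le_dist (not_lt.1 hzx), zero_smul, norm_zero]
          exact hn
      have h2 : ρ z • (z - x) = -x := (neg_eq_of_add_eq_zero_right hz).symm
      rw [h2, norm_neg] at h1
      exact lt_irrefl _ h1
    have hΦc : ContDiff ℝ ∞ Φ := contDiff_const.add (ρ.contDiff.smul (contDiff_id.sub contDiff_const))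
    have hN : ContDiff ℝ ∞ fun z => ‖Φ z‖⁻¹ • Φ z :=
      ((hΦc.norm ℝ hΦ0).inv fun z => norm_ne_zero_iff.2 (hΦ0 z)).smul hΦc
    have hc : ContMDiff 𝓘(ℝ, E4) 𝓘(ℝ, ℝ) ∞ (ξ ∘ Set.codRestrict (fun z => ‖Φ z‖⁻¹ • Φ z)
        (sphere (0 : E4) 1) fun z => hmem _ (hΦ0 z)) :=
      hξ.comp (hN.contMDiff.codRestrict_sphere _)
    refine hc.contDiff.contDiffAt.congr_of_eventuallyEq ?_
    filter_upwards [ball_mem_nhds x (show 0 < ‖x‖ / 4 by positivity)] with z hz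
    have hz1 : Φ z = z := by
      have : ρ z = 1 := ρ.one_of_mem_closedBall (ball_subset_closedBall hz)
      simp [Φ, this]
    have hz0 : z ≠ 0 := hz1 ▸ hΦ0 z
    simp only [e, dif_pos hz0, Function.comp_apply]
    congr 1
    ext1
    simp [hz1]
  -- Vanishes for |x|² ≤ 1/2, removing the singularity of the radial extension at 0, and equals 1 on
  -- the sphere.
  let χ : E4 → ℝ := fun x => Real.smoothTransition (2 * ‖x‖ ^ 2 - 1)
  have hχ : ContDiff ℝ ∞ χ := Real.smoothTransition.contDiff.comp
    ((contDiff_const.mul (contDiff_norm_sq ℝ)).sub contDiff_const)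
  refine ⟨fun x => χ x * e x, ?_, fun y => ?_⟩
  · rw [contDiff_iff_contDiffAt]
    intro x
    rcases eq_or_ne x 0 with rfl | hx
    · refine contDiffAt_const (c := (0 : ℝ)) |>.congr_of_eventuallyEq ?_
      filter_upwards [ball_mem_nhds (0 : E4) (show (0 : ℝ) < 1 / 2 by norm_num)] with z hz
      have hz : ‖z‖ < 1 / 2 := by simpa using hz
      have : χ z = 0 := Real.smoothTransition.zero_of_nonpos (by nlinarith [norm_nonneg z])
      simp [this]
    · exact hχ.contDiffAt.mul (he x hx)
  · have hy : ‖(y : E4)‖ = 1 := by simp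
    have hy0 : (y : E4) ≠ 0 := norm_ne_zero_iff.1 (by simp)
    have : χ y = 1 := Real.smoothTransition.one_of_one_le (by rw [hy]; norm_num)
    simp only [this, one_mul, e, dif_pos hy0]
    congr 1
    ext1
    simp

theorem mvfderiv_of_extension {ξ : S3 → ℝ} {Ξ : E4 → ℝ} (hΞ : ContDiff ℝ ∞ Ξ)
    (h : ∀ y : S3, Ξ y = ξ y) (y : S3) (v : TangentSpace (𝓡 3) y) :
    mvfderiv (𝓡 3) ξ y v = fderiv ℝ Ξ y (mvfderiv (𝓡 3) sphereIncl y v) := by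
  have h1 : ξ = Ξ ∘ sphereIncl := funext fun z => (h z).symm
  have hd : DifferentiableAt ℝ Ξ (sphereIncl y) := hΞ.differentiable (by simp) _
  have hi : MDifferentiableAt (𝓡 3) 𝓘(ℝ, E4) sphereIncl y :=
    (contMDiff_coe_sphere y).mdifferentiableAt one_ne_zero
  have h2 := mfderiv_comp_apply y hd.mdifferentiableAt hi v
  rw [mfderiv_eq_fderiv] at h2
  rw [h1]
  exact h2

theorem spherePullback_apply (A : OneForm) (y : S3) (v : TangentSpace (𝓡 3) y) :
    spherePullback A y v = A y ![mvfderiv (𝓡 3) sphereIncl y v] := by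
  change A y (fun _ => mvfderiv (𝓡 3) sphereIncl y v) = _
  congr 1
  ext i; fin_cases i; rfl

theorem exists_mvfderiv_sphereIncl_eq {y : S3} {w : E4} (hw : inner ℝ (y : E4) w = 0) :
    ∃ v : TangentSpace (𝓡 3) y, mvfderiv (𝓡 3) sphereIncl y v = w := by
  have h : w ∈ (mvfderiv (𝓡 3) ((↑) : S3 → E4) y).range := by
    rw [range_mvfderiv_subtypeVal, Submodule.mem_orthogonal_singleton_iff_inner_right]
    exact hw
  exact h

theorem oneForm_apply_eq_sum (α : E4 [⋀^Fin 1]→L[ℝ] ℝ) (w : E4) :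
    α ![w] = ∑ j, w j * α ![stdVec j] := by
  have h : ∀ u, α ![u] = (ContinuousAlternatingMap.ofSubsingleton ℝ E4 ℝ (0 : Fin 1)).symm α u :=
    fun u => by
      change _ = α (fun _ => u)
      congr 1
      ext i; fin_cases i; rfl
  simp only [h]
  conv_lhs => rw [← sum_smul_stdVec w]
  simp [map_sum]

theorem fderiv_component {A : OneForm} {x : E4} (hA : DifferentiableAt ℝ A x) (w v : E4) :
    fderiv ℝ (fun y => A y ![w]) x v = fderiv ℝ A x v ![w] := by
  have h : HasFDerivAt (fun y => A y ![w]) ((evalOne w).comp (fderiv ℝ A x)) x :=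
    (evalOne w).hasFDerivAt.comp x hA.hasFDerivAt
  rw [h.fderiv]
  rfl

theorem contDiffAt_curv {A : OneForm} {x : E4} (hA : ContDiffAt ℝ 2 A x) (i j : Fin 4) :
    ContDiffAt ℝ 1 (fun y => curv A y i j) x := by
  have h : ∀ u w : E4, ContDiffAt ℝ 1 (fun y => evalOne w (fderiv ℝ A y u)) x := fun u w =>
    (evalOne w).contDiff.contDiffAt.comp x
      ((hA.fderiv_right (m := 1) (by norm_num)).clm_apply contDiffAt_const)
  simp only [curv_apply]
  exact (h _ _).sub (h _ _)

theorem exists_lipschitzOnWith_component {A : OneForm}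
    (hA : ContDiffOn ℝ ∞ A (closedBall 0 1)) (w : E4) :
    ∃ K, LipschitzOnWith K (fun y => A y ![w]) (closedBall 0 1) :=
  ((evalOne w).contDiff.comp_contDiffOn hA).exists_lipschitzOnWith (by simp)
    (convex_closedBall _ _) (isCompact_closedBall _ _)

theorem contDiffAt_of_contDiffOn_closedBall {A : OneForm}
    (hA : ContDiffOn ℝ ∞ A (closedBall 0 1)) {x : E4} (hx : x ∈ B4) : ContDiffAt ℝ 2 A x :=
  (hA.contDiffAt (Filter.mem_of_superset (isOpen_ball.mem_nhds hx)
    ball_subset_closedBall)).of_le ENat.LEInfty.out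

/-- Smoothness on the compact convex closed ball gives a Lipschitz constant, which bounds the
derivative inside without using derivatives at boundary points. -/
theorem bddOnBall_curv {A : OneForm} (hA : ContDiffOn ℝ ∞ A (closedBall 0 1)) (i j : Fin 4) :
    BddOnBall fun x => curv A x i j := by
  have hb : ∀ u w : E4, BddOnBall fun x => fderiv ℝ A x u ![w] := fun u w => by
    obtain ⟨K, hK⟩ := exists_lipschitzOnWith_component hA w
    refine bddOnBall_of_continuousOn (C := K * ‖u‖) (fun x hx => ?_) fun x hx => ?_
    · have h : ContDiffAt ℝ 1 (fun y => evalOne w (fderiv ℝ A y u)) x :=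
        (evalOne w).contDiff.contDiffAt.comp x
          (((contDiffAt_of_contDiffOn_closedBall hA hx).fderiv_right (m := 1)
            (by norm_num)).clm_apply contDiffAt_const)
      exact h.continuousAt.continuousWithinAt
    · have h := norm_fderiv_le_of_lipschitzOn ℝ
        (Filter.mem_of_superset (isOpen_ball.mem_nhds hx) ball_subset_closedBall) hK
      rw [← fderiv_component
        ((contDiffAt_of_contDiffOn_closedBall hA hx).differentiableAt (by simp)) w u]
      exact ((fderiv ℝ (fun y => A y ![w]) x).le_opNorm u).trans (by gcongr)
  simp only [curv_apply]
  exact (hb _ _).sub (hb _ _)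

/-! ### Uniqueness of the curvature -/

/-- Two solutions with the same boundary value have the same curvature. -/
theorem SolvesLinearDirichlet.curv_ae_eq {a : SphereLieOneForm} {A A' : LieOneForm}
    (hA : SolvesLinearDirichlet a A) (hA' : SolvesLinearDirichlet a A') (l : Fin 3) :
    ∀ᵐ x ∂(volume.restrict B4), curv (A l) x = curv (A' l) x := by
  obtain ⟨ξ, hξ, hb⟩ := hA.boundary
  obtain ⟨ξ', hξ', hb'⟩ := hA'.boundary
  obtain ⟨X, hX, hXe⟩ := exists_contDiff_extension (hξ l)
  obtain ⟨X', hX', hXe'⟩ := exists_contDiff_extension (hξ' l)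
  set Y : E4 → ℝ := fun x => X x - X' x with hYdef
  have hY : ContDiff ℝ ∞ Y := hX.sub hX'
  have hYf : ∀ j, ContDiff ℝ ∞ fun x => fderiv ℝ Y x (stdVec j) := fun j =>
    (hY.fderiv_right (m := ∞) (by simp)).clm_apply contDiff_const
  have hYd : ∀ x w, fderiv ℝ Y x w = fderiv ℝ X x w - fderiv ℝ X' x w := fun x w => by
    rw [hYdef, fderiv_fun_sub (hX.differentiable (by simp) x) (hX'.differentiable (by simp) x)]
    rfl
  -- Y extends ξ - ξ' from the sphere. Subtracting dY cancels the tangential difference of the two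
  -- solutions and leaves the curvature unchanged.
  let C : Fin 4 → E4 → ℝ := fun j x =>
    A l x ![stdVec j] - A' l x ![stdVec j] - fderiv ℝ Y x (stdVec j)
  have hcomp : ∀ (B : OneForm), ContDiffOn ℝ ∞ B (closedBall 0 1) → ∀ j,
      ContDiffOn ℝ ∞ (fun x => B x ![stdVec j]) (closedBall 0 1) := fun B hB j =>
    (evalOne (stdVec j)).contDiff.comp_contDiffOn hB
  have hCs : ∀ j, ContDiffOn ℝ ∞ (C j) (closedBall 0 1) := fun j =>
    ((hcomp _ (hA.smooth l) j).sub (hcomp _ (hA'.smooth l) j)).sub (hYf j).contDiffOn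
  choose K hK using fun j => (hCs j).exists_lipschitzOnWith (by simp)
    (convex_closedBall (0 : E4) 1) (isCompact_closedBall _ _)
  let F : Fin 4 → Fin 4 → E4 → ℝ := fun i j x =>
    fderiv ℝ (C j) x (stdVec i) - fderiv ℝ (C i) x (stdVec j)
  have hFeq : ∀ x ∈ B4, ∀ i j, F i j x = curv (A l) x i j - curv (A' l) x i j := by
    intro x hx i j
    have hd := (contDiffAt_of_contDiffOn_closedBall (hA.smooth l) hx).differentiableAt
      two_ne_zero
    have hd' := (contDiffAt_of_contDiffOn_closedBall (hA'.smooth l) hx).differentiableAt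
      two_ne_zero
    have hdc : ∀ {B : OneForm}, DifferentiableAt ℝ B x → ∀ w,
        DifferentiableAt ℝ (fun y => B y ![w]) x := fun hB w =>
      (evalOne w).differentiableAt.comp x hB
    have hp : ∀ i j, fderiv ℝ (C j) x (stdVec i) = fderiv ℝ (A l) x (stdVec i) ![stdVec j] -
        fderiv ℝ (A' l) x (stdVec i) ![stdVec j] -
        fderiv ℝ (fun y => fderiv ℝ Y y (stdVec j)) x (stdVec i) := fun i j => by
      have : fderiv ℝ (C j) x = _ := fderiv_fun_sub
        ((hdc hd (stdVec j)).fun_sub (hdc hd' (stdVec j)))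
        ((hYf j).differentiable (by simp) x)
      rw [this, fderiv_fun_sub (hdc hd (stdVec j)) (hdc hd' (stdVec j))]
      simp only [sub_apply, fderiv_component hd, fderiv_component hd']
    have hsymm := fderiv_fderiv_apply_comm
      (hY.contDiffAt.of_le ENat.LEInfty.out : ContDiffAt ℝ 2 Y x) (stdVec i) (stdVec j)
    simp only [F, hp, curv_apply, hsymm]
    ring
  have hdiv : ∀ x ∈ B4, ∀ j, ∑ i, fderiv ℝ (F i j) x (stdVec i) = 0 := by
    intro x hx j
    have hc := fun i => (contDiffAt_curv (contDiffAt_of_contDiffOn_closedBall (hA.smooth l) hx)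
      i j).differentiableAt one_ne_zero
    have hc' := fun i => (contDiffAt_curv (contDiffAt_of_contDiffOn_closedBall (hA'.smooth l) hx)
      i j).differentiableAt one_ne_zero
    have hterm : ∀ i, fderiv ℝ (F i j) x (stdVec i) =
        fderiv ℝ (fun y => curv (A l) y i j) x (stdVec i) -
        fderiv ℝ (fun y => curv (A' l) y i j) x (stdVec i) := fun i => by
      have : F i j =ᶠ[nhds x] fun y => curv (A l) y i j - curv (A' l) y i j := by
        filter_upwards [isOpen_ball.mem_nhds hx] with y hy using hFeq y hy i j
      rw [this.fderiv_eq, fderiv_fun_sub (hc i) (hc' i)]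
      rfl
    rw [Finset.sum_congr rfl fun i _ => hterm i, Finset.sum_sub_distrib]
    have h1 := hA.eqn l x hx j
    have h2 := hA'.eqn l x hx j
    simp only [codiff] at h1 h2
    linarith
  have htan : ∀ y ∈ sphere (0 : E4) 1, ∀ w : E4, inner ℝ y w = 0 → ∑ j, w j * C j y = 0 := by
    intro y hy w hw
    obtain ⟨v, hv⟩ := exists_mvfderiv_sphereIncl_eq (y := ⟨y, hy⟩) hw
    have h1 := hb l ⟨y, hy⟩ v
    have h2 := hb' l ⟨y, hy⟩ v
    rw [spherePullback_apply, mvfderiv_of_extension hX hXe, hv] at h1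
    rw [spherePullback_apply, mvfderiv_of_extension hX' hXe', hv] at h2
    have h3 : ∑ j, w j * C j y = A l y ![w] - A' l y ![w] - fderiv ℝ Y y w := by
      rw [oneForm_apply_eq_sum (A l y), oneForm_apply_eq_sum (A' l y), fderiv_eq_sum_stdVec y w,
        ← Finset.sum_sub_distrib, ← Finset.sum_sub_distrib]
      exact Finset.sum_congr rfl fun j _ => by simp only [C]; ring
    rw [h3, hYd]
    simp only at h1 h2
    linarith
  have hae := ae_curl_eq_zero (F := F) (K := ∑ j, K j)
    (fun j => ((hCs j).mono ball_subset_closedBall).of_le ENat.LEInfty.out)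
    (fun j => (hK j).weaken (Finset.single_le_sum (fun _ _ => zero_le) (Finset.mem_univ j)))
    (fun _ _ _ => rfl) hdiv htan
  filter_upwards [hae, ae_restrict_mem measurableSet_ball] with x hx hxb
  ext i j
  have := hFeq x hxb i j
  rw [hx] at this
  linarith

/-! ### The effect of the shift on the boundary matrix -/

theorem curv_shiftedConnection {A : LieOneForm} (a : Matrix (Fin 3) (Fin 3) ℝ) {l : Fin 3}
    {x : E4} (hA : DifferentiableAt ℝ (A l) x) (i j : Fin 4) :
    curv (shiftedConnection A a l) x i j = curv (A l) x i j + ∑ k, a k l * asdBasis k i j := by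
  have hs : ∀ k, HasFDerivAt (fun y => a k l • asdPotential k y) (a k l • asdPotentialCLM k) x :=
    fun k => by
      rw [asdPotential_eq]
      exact (a k l • asdPotentialCLM k).hasFDerivAt
  have h : HasFDerivAt (shiftedConnection A a l)
      (fderiv ℝ (A l) x + ∑ k, a k l • asdPotentialCLM k) x :=
    hA.hasFDerivAt.add (HasFDerivAt.fun_sum fun k _ => hs k)
  rw [curv_apply, curv_apply, h.fderiv]
  simp [asdBasis, Fin.sum_univ_three]
  ring

/-- The curvature changes by a constant, which the codifferential annihilates; the boundary value is
the pull-back itself, so ξ = 0 works. -/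
theorem solves_shiftedConnection {A₀ : SphereLieOneForm} {A : LieOneForm}
    (hA : SolvesLinearDirichlet A₀ A) (a : Matrix (Fin 3) (Fin 3) ℝ) :
    SolvesLinearDirichlet (shiftedBoundary A a) (shiftedConnection A a) := by
  refine ⟨fun l => ?_, fun l x hx j => ?_, fun _ _ => 0, fun _ => contMDiff_const,
    fun l y v => ?_⟩
  · refine (hA.smooth l).add (ContDiff.contDiffOn ?_)
    refine ContDiff.sum fun k _ => ?_
    rw [asdPotential_eq]
    exact (a k l • asdPotentialCLM k).contDiff
  · rw [← hA.eqn l x hx j, codiff, codiff]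
    congr 1
    refine Finset.sum_congr rfl fun i _ => ?_
    have : (fun y => curv (shiftedConnection A a l) y i j) =ᶠ[nhds x]
        fun y => curv (A l) y i j + ∑ k, a k l * asdBasis k i j := by
      filter_upwards [isOpen_ball.mem_nhds hx] with y hy
      exact curv_shiftedConnection a ((contDiffAt_of_contDiffOn_closedBall (hA.smooth l)
        hy).differentiableAt two_ne_zero) i j
    rw [this.fderiv_eq, fderiv_add_const]
  · have h0 : mvfderiv (𝓡 3) (fun _ : S3 => (0 : ℝ)) y = 0 := mvfderiv_const _
    rw [h0]
    simp [shiftedBoundary]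

theorem IsHarmonicPotential.curv_eq {p : E4} {h h' : LieOneForm} (hh : IsHarmonicPotential p h)
    (hh' : IsHarmonicPotential p h') (l : Fin 3) {x : E4} (hx : x ∈ B4) :
    curv (h l) x = curv (h' l) x := by
  have : h l =ᶠ[nhds x] h' l := by
    filter_upwards [isOpen_ball.mem_nhds hx] with y hy
    exact hh.eqOn hh' l (ball_subset_closedBall hy)
  rw [curv, curv, extDeriv, extDeriv, this.fderiv_eq]

/-- The dependence of the boundary matrix on the shift. -/
theorem isBoundaryMatrix_shiftedBoundary {A₀ : SphereLieOneForm} {A : LieOneForm}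
    (hA : SolvesLinearDirichlet A₀ A) {p : E4} (hp : p ∈ B4) (a : Matrix (Fin 3) (Fin 3) ℝ) :
    IsBoundaryMatrix (shiftedBoundary A a) p (Matrix.of fun i j =>
      (∫ x in B4, twoFormInner (asdPart (curv (A j) x)) (asdPart (curv (kelvinPotential p i) x))) +
        4 * (volume B4).toReal * a i j) := by
  refine ⟨⟨_, solves_shiftedConnection hA a⟩, ⟨_, isHarmonicPotential_kelvinPotential hp⟩, ?_⟩
  intro A' h hA' hh i j
  have hint : ∀ F : E4 → Matrix (Fin 4) (Fin 4) ℝ, (∀ i j, BddOnBall fun x => F x i j) →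
      IntegrableOn (fun x => twoFormInner (asdPart (F x))
        (asdPart (curv (kelvinPotential p i) x))) B4 := fun F hF =>
    (bddOnBall_asd hF (bddOnBall_curv_kelvinPotential hp i)).integrableOn
  have h1 := hint (curv (A j)) (bddOnBall_curv (hA.smooth j))
  have h2 : ∀ k, IntegrableOn (fun x => twoFormInner (asdPart (asdBasis k))
      (asdPart (curv (kelvinPotential p i) x))) B4 := fun k =>
    hint (fun _ => asdBasis k) fun i j =>
      bddOnBall_of_continuousOn (C := |asdBasis k i j|) continuousOn_const fun _ _ => le_rfl
  have h2' : IntegrableOn (fun x => ∑ k, a k j * twoFormInner (asdPart (asdBasis k))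
      (asdPart (curv (kelvinPotential p i) x))) B4 :=
    integrable_finsetSum _ fun k _ => (h2 k).const_mul _
  -- Uniqueness replaces the arbitrary solutions A' and h by the shifted connection and the Kelvin
  -- potential.
  have hae : (fun x => twoFormInner (asdPart (curv (A' j) x)) (asdPart (curv (h i) x)))
      =ᵐ[volume.restrict B4] fun x =>
        twoFormInner (asdPart (curv (A j) x)) (asdPart (curv (kelvinPotential p i) x)) +
          ∑ k, a k j * twoFormInner (asdPart (asdBasis k))
            (asdPart (curv (kelvinPotential p i) x)) := by
    filter_upwards [hA'.curv_ae_eq (solves_shiftedConnection hA a) j,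
      ae_restrict_mem measurableSet_ball] with x hx hxb
    rw [hx, hh.curv_eq (isHarmonicPotential_kelvinPotential hp) i hxb]
    simp only [twoFormInner_asdPart, curv_shiftedConnection a
      ((contDiffAt_of_contDiffOn_closedBall (hA.smooth j) hxb).differentiableAt two_ne_zero),
      Fin.sum_univ_three]
    ring
  refine ⟨(h1.add h2').congr hae.symm, ?_⟩
  rw [integral_congr_ae hae, integral_add h1 h2',
    integral_finsetSum _ fun k _ => (h2 k).const_mul _]
  simp only [integral_const_mul, integral_asdPairing hp, asdPairing_asdBasis_id, Matrix.of_apply]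
  simp
  ring

/-! ### Diagonal witnesses and the conclusion -/

theorem areGramEigenvalues_diagonal {a b c : ℝ} (h₁ : b ^ 2 ≤ a ^ 2) (h₂ : c ^ 2 ≤ b ^ 2) :
    AreGramEigenvalues (Matrix.diagonal ![a, b, c]) (a ^ 2) (b ^ 2) (c ^ 2) := by
  refine ⟨h₁, h₂, ?_⟩
  rw [Matrix.diagonal_transpose, Matrix.diagonal_mul_diagonal, Matrix.charpoly_diagonal,
    Fin.prod_univ_three, ← Polynomial.roots_multiset_prod_X_sub_C {a ^ 2, b ^ 2, c ^ 2}]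
  congr 1
  simp [sq, mul_assoc]

end

theorem proposition8p1 (A₀ : SphereLieOneForm) (A : LieOneForm)
    (hA : SolvesLinearDirichlet A₀ A) (p₀ : E4) (hp₀ : p₀ ∈ B4) :
    (∀ M : Matrix (Fin 3) (Fin 3) ℝ, ∃ a : Matrix (Fin 3) (Fin 3) ℝ,
      IsBoundaryMatrix (shiftedBoundary A a) p₀ M) ∧
    (∃ a N : Matrix (Fin 3) (Fin 3) ℝ,
      IsBoundaryMatrix (shiftedBoundary A a) p₀ N ∧ PositiveCase N) ∧
    (∃ a N : Matrix (Fin 3) (Fin 3) ℝ,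
      IsBoundaryMatrix (shiftedBoundary A a) p₀ N ∧ NegativeCase N) ∧
    (∃ a N : Matrix (Fin 3) (Fin 3) ℝ,
      IsBoundaryMatrix (shiftedBoundary A a) p₀ N ∧ NegativeTriangleCase N) ∧
    (∃ a N : Matrix (Fin 3) (Fin 3) ℝ,
      IsBoundaryMatrix (shiftedBoundary A a) p₀ N ∧ DegenerateCase N) := by
  have hvol : 0 < (volume B4).toReal :=
    ENNReal.toReal_pos (measure_ball_pos volume _ one_pos).ne' measure_ball_lt_top.ne
  have hmain : ∀ M : Matrix (Fin 3) (Fin 3) ℝ, ∃ a : Matrix (Fin 3) (Fin 3) ℝ,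
      IsBoundaryMatrix (shiftedBoundary A a) p₀ M := fun M => by
    -- The affine relation M(a) = M(0) + 4 vol(B⁴) a, solved for a.
    refine ⟨Matrix.of fun i j => (M i j - ∫ x in B4, twoFormInner (asdPart (curv (A j) x))
      (asdPart (curv (kelvinPotential p₀ i) x))) / (4 * (volume B4).toReal), ?_⟩
    convert! isBoundaryMatrix_shiftedBoundary hA hp₀ _ using 1
    ext i j
    simp only [Matrix.of_apply]
    rw [mul_div_cancel₀ _ (by positivity)]
    ring
  -- Determinant -24 and singular values 4 < 3 + 2; the same witness serves both negative cases.
  have hneg : NegativeTriangleCase (Matrix.diagonal ![-4, 3, 2]) := by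
    refine ⟨by simp [Matrix.det_diagonal, Fin.prod_univ_three], _, _, _,
      areGramEigenvalues_diagonal (by norm_num) (by norm_num), by norm_num, by norm_num, ?_⟩
    simp only [Real.sqrt_sq_eq_abs]
    norm_num
  refine ⟨hmain, ?_, ?_, ?_, ?_⟩
  -- Singular values with 4 > 2 + 1.
  · obtain ⟨a, ha⟩ := hmain (Matrix.diagonal ![4, 2, 1])
    refine ⟨a, _, ha, by simp [Matrix.det_diagonal, Fin.prod_univ_three], _, _, _,
      areGramEigenvalues_diagonal (by norm_num) (by norm_num), by norm_num, by norm_num, ?_⟩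
    simp only [Real.sqrt_sq_eq_abs]
    norm_num
  · obtain ⟨a, ha⟩ := hmain (Matrix.diagonal ![-4, 3, 2])
    obtain ⟨hdet, μ₁, μ₂, μ₃, hμ, h₁, h₂, -⟩ := hneg
    exact ⟨a, _, ha, hdet, μ₁, μ₂, μ₃, hμ, h₁, h₂⟩
  · obtain ⟨a, ha⟩ := hmain (Matrix.diagonal ![-4, 3, 2])
    exact ⟨a, _, ha, hneg⟩
  · obtain ⟨a, ha⟩ := hmain (Matrix.diagonal ![2, 1, 0])
    exact ⟨a, _, ha, by simp [Matrix.det_diagonal, Fin.prod_univ_three], _, _, _,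
      areGramEigenvalues_diagonal (by norm_num) (by norm_num), by norm_num, by norm_num⟩
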